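/- Let $L$ be a finite-dimensional complex solvable Lie algebra and let $E\neq 0$ be a complex Banach space on which $L$ acts on the right by bounded operators, i.e. through a homomorphism of Lie algebras from $L$ to the bounded operators on $E$ with the opposite product, so that $e\cdot[x,y]=(e\cdot x)\cdot y-(e\cdot y)\cdot x$. For a Lie algebra $M$ acting in this way on $E$ and a character $f$ of $M$ (a linear functional $f\in M^*$ with $f([M,M])=0$), let $H_*(M,E\otimes\mathbb C(f))$ be the homology of the complex $(E\otimes\bigwedge^p M)_{p\ge 0}$ with boundary $$ d(e\otimes x_1\wedge\cdots\wedge x_p)=\sum_{k=1}^p(-1)^{k+1}(e\cdot x_k-f(x_k)e)\otimes x_1\wedge\cdots\wedge\hat x_k\wedge\cdots\wedge x_p+\sum_{1\le k<l\le p}(-1)^{k+l}\,e\otimes[x_k,x_l]\wedge x_1\wedge\cdots\wedge\hat x_k\wedge\cdots\wedge\hat x_l\wedge\cdots\wedge x_p , $$ and let $Sp(M,E)\subseteq M^*$ be the set of characters $f$ of $M$ for which $H_*(M,E\otimes\mathbb C(f))\neq 0$. Write $L^2=[L,L]$. If $I$ is an ideal of $L$ contained in $L^2$, acting on $E$ by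 restriction, then $Sp(I,E)=\{0\}$. In particular, $Sp(L^2,E)=\{0\}$. -/

import Mathlib

noncomputable section

open scoped TensorProduct

namespace LieSpectrum

variable {L : Type*} [LieRing L] [LieAlgebra ℂ L]
  {E : Type*} [NormedAddCommGroup E] [NormedSpace ℂ E]

/-- A right action of the Lie algebra `L` on `E` by bounded operators: a homomorphism of Lie
algebras from `L` to the bounded operators on `E` with the opposite product, so that, with
`e · x = op x e`, one has `e · [x, y] = (e · x) · y - (e · y) · x`. -/
structure RightAction (L : Type*) [LieRing L] [LieAlgebra ℂ L]
    (E : Type*) [NormedAddCommGroup E] [NormedSpace ℂ E] where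
  /-- The operator `e ↦ e · x`. -/
  op : L →ₗ[ℂ] (E →L[ℂ] E)
  op_lie : ∀ x y : L, op ⁅x, y⁆ = op y * op x - op x * op y

/-- The restriction of a right action to an ideal. -/
def RightAction.restrict (ρ : RightAction L E) (I : LieIdeal ℂ L) : RightAction I E where
  op := ρ.op ∘ₗ (I : Submodule ℂ L).subtype
  op_lie x y := ρ.op_lie x y

/-- The alternating map `(x₀, …, x_{p-1}) ↦ z ∧ x₀ ∧ ⋯ ∧ x_{p-1}`, linear in `z`. -/
def wedgeLeft (L : Type*) [AddCommGroup L] [Module ℂ L] (p : ℕ) :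
    L →ₗ[ℂ] L [⋀^Fin p]→ₗ[ℂ] ⋀[ℂ]^(p + 1) L :=
  (exteriorPower.ιMulti ℂ (p + 1) (M := L)).curryLeft

/-- The sum `∑_{k < l} (-1)^(k+l) [x_k, x_l] ∧ x₀ ∧ ⋯ (x_k, x_l omitted) ⋯ ∧ x_{p+1}`. A pair of
positions `k < l` in `Fin (p + 2)` is encoded as `k = i.castSucc`, `l = j.succ` with `i ≤ j`
in `Fin (p + 1)`. -/
def bracketSum (p : ℕ) (x : Fin (p + 2) → L) : ⋀[ℂ]^(p + 1) L :=
  ∑ i : Fin (p + 1), ∑ j ≥ i, (-1 : ℤ) ^ ((i.castSucc : ℕ) + (j.succ : ℕ)) •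
    exteriorPower.ιMulti ℂ (p + 1)
      (Matrix.vecCons ⁅x i.castSucc, x j.succ⁆ (j.removeNth (i.castSucc.removeNth x)))

/-- The map `(x, y) ↦ ((z₀, …) ↦ [x, y] ∧ z₀ ∧ ⋯)`. -/
def bracketWedge (L : Type*) [LieRing L] [LieAlgebra ℂ L] (p : ℕ) :
    L →ₗ[ℂ] L →ₗ[ℂ] L [⋀^Fin p]→ₗ[ℂ] ⋀[ℂ]^(p + 1) L :=
  LinearMap.mk₂ ℂ (fun x y => wedgeLeft L p ⁅x, y⁆)
    (by intros; simp) (by intros; simp) (by intros; simp) (by intros; simp)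

/-- `bracketSum` is alternating: it is an alternatization of `bracketWedge`. -/
theorem bracketSum_eq (p : ℕ) (x : Fin (p + 2) → L) :
    bracketSum p x = AlternatingMap.alternatizeUncurryFin (AlternatingMap.alternatizeUncurryFinLM ∘ₗ
      ((-(1 / 2 : ℂ)) • bracketWedge L p)) x := by
  rw [AlternatingMap.alternatizeUncurryFin_alternatizeUncurryFinLM_comp_apply, bracketSum]
  refine Finset.sum_congr rfl fun i _ => Finset.sum_congr rfl fun j _ => ?_
  have h : ∀ (a b : L) (v : Fin p → L),
      ((-(1 / 2 : ℂ)) • bracketWedge L p) a b v - ((-(1 / 2 : ℂ)) • bracketWedge L p) b a v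
        = -(wedgeLeft L p ⁅a, b⁆ v) := by
    intro a b v
    have hb : wedgeLeft L p ⁅b, a⁆ v = -(wedgeLeft L p ⁅a, b⁆ v) := by
      rw [← lie_skew b a, map_neg, AlternatingMap.neg_apply]
    simp only [LinearMap.smul_apply, AlternatingMap.smul_apply, bracketWedge, LinearMap.mk₂_apply,
      hb]
    module
  rw [h]
  simp only [wedgeLeft, AlternatingMap.curryLeft_apply_apply, Fin.val_castSucc, Fin.val_succ,
    ← add_assoc, pow_succ]
  simp

/-- `bracketSum` as an alternating map. -/
def bracketSumAlt (L : Type*) [LieRing L] [LieAlgebra ℂ L] (p : ℕ) :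
    L [⋀^Fin (p + 2)]→ₗ[ℂ] ⋀[ℂ]^(p + 1) L where
  toFun := bracketSum p
  map_update_add' x i a b := by
    simp only [bracketSum_eq]
    convert AlternatingMap.map_update_add _ x i a b
  map_update_smul' x i c a := by
    simp only [bracketSum_eq]
    convert AlternatingMap.map_update_smul _ x i c a
  map_eq_zero_of_eq' x i j hij hne := by
    simp only [bracketSum_eq]
    exact AlternatingMap.map_eq_zero_of_eq _ x hij hne

/-- The bracket part of the boundary, `⋀^(p+1) L → ⋀^p L`:
`x₀ ∧ ⋯ ∧ x_p ↦ ∑_{k < l} (-1)^(k+l) [x_k, x_l] ∧ x₀ ∧ ⋯ (x_k, x_l omitted) ⋯ ∧ x_p`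
(an empty sum for `p = 0`). -/
def bracketPart (L : Type*) [LieRing L] [LieAlgebra ℂ L] :
    ∀ p : ℕ, ⋀[ℂ]^(p + 1) L →ₗ[ℂ] ⋀[ℂ]^p L
  | 0 => 0
  | p + 1 => exteriorPower.alternatingMapLinearEquiv (bracketSumAlt L p)

/-- The right action on `E ⊗ ℂ(f)`: `twistedAction ρ f x e = e · x - f(x) e`. -/
def twistedAction (ρ : RightAction L E) (f : Module.Dual ℂ L) : L →ₗ[ℂ] E →ₗ[ℂ] E :=
  LinearMap.mk₂ ℂ (fun x e => ρ.op x e - f x • e)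
    (by intros; simp [add_smul]; abel)
    (by intros; simp [smul_sub, smul_smul])
    (by intros; simp; abel)
    (by intros; simp [smul_sub, smul_smul, mul_comm])

/-- The map `x ↦ ((z₀, …, z_{p-1}) ↦ (e ↦ (e · x - f(x) e) ⊗ (z₀ ∧ ⋯ ∧ z_{p-1})))`. -/
def actionWedge (ρ : RightAction L E) (f : Module.Dual ℂ L) (p : ℕ) :
    L →ₗ[ℂ] L [⋀^Fin p]→ₗ[ℂ] (E →ₗ[ℂ] E ⊗[ℂ] ⋀[ℂ]^p L) where
  toFun x := ((TensorProduct.mk ℂ E (⋀[ℂ]^p L) ∘ₗ twistedAction ρ f x).flip).compAlternatingMap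
    (exteriorPower.ιMulti ℂ p)
  map_add' x y := by
    ext z e
    simp
  map_smul' c x := by
    ext z e
    simp [TensorProduct.smul_tmul']

/-- The action part of the boundary, `E ⊗ ⋀^(p+1) L → E ⊗ ⋀^p L`:
`e ⊗ x₀ ∧ ⋯ ∧ x_p ↦ ∑_k (-1)^k (e · x_k - f(x_k) e) ⊗ x₀ ∧ ⋯ (x_k omitted) ⋯ ∧ x_p`. -/
def actionPart (ρ : RightAction L E) (f : Module.Dual ℂ L) (p : ℕ) :
    E ⊗[ℂ] ⋀[ℂ]^(p + 1) L →ₗ[ℂ] E ⊗[ℂ] ⋀[ℂ]^p L :=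
  TensorProduct.lift (exteriorPower.alternatingMapLinearEquiv
    (AlternatingMap.alternatizeUncurryFin (actionWedge ρ f p))).flip

/-- The boundary `d_p(f) : E ⊗ ⋀^(p+1) L → E ⊗ ⋀^p L` of the complex `(E ⊗ ⋀ L, d(f))`. -/
def boundary (ρ : RightAction L E) (f : Module.Dual ℂ L) (p : ℕ) :
    E ⊗[ℂ] ⋀[ℂ]^(p + 1) L →ₗ[ℂ] E ⊗[ℂ] ⋀[ℂ]^p L :=
  actionPart ρ f p + (bracketPart L p).lTensor E

/-- The boundary from `E ⊗ L` to `E ⊗ ⋀^0 L` is `e ⊗ x ↦ e · x - f(x) e`. -/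
theorem boundary_zero_tmul (ρ : RightAction L E) (f : Module.Dual ℂ L) (e : E)
    (x : Fin 1 → L) :
    boundary ρ f 0 (e ⊗ₜ exteriorPower.ιMulti ℂ 1 x) =
      (ρ.op (x 0) e - f (x 0) • e) ⊗ₜ exteriorPower.ιMulti ℂ 0 ![] := by
  simp [boundary, actionPart, bracketPart, AlternatingMap.alternatizeUncurryFin_apply, actionWedge,
    twistedAction, TensorProduct.sub_tmul, TensorProduct.smul_tmul',
    exteriorPower.alternatingMapLinearEquiv_apply_ιMulti, Subsingleton.elim _ ![],
    -exteriorPower.ιMulti_apply_coe]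

/-- The explicit formula for the boundary in positive degrees. -/
theorem boundary_succ_tmul (ρ : RightAction L E) (f : Module.Dual ℂ L) (p : ℕ) (e : E)
    (x : Fin (p + 2) → L) :
    boundary ρ f (p + 1) (e ⊗ₜ exteriorPower.ιMulti ℂ (p + 2) x) =
      ∑ k : Fin (p + 2), (-1 : ℤ) ^ (k : ℕ) •
        ((ρ.op (x k) e - f (x k) • e) ⊗ₜ[ℂ] exteriorPower.ιMulti ℂ (p + 1) (k.removeNth x)) +
      ∑ i : Fin (p + 1), ∑ j ≥ i, (-1 : ℤ) ^ ((i.castSucc : ℕ) + (j.succ : ℕ)) •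
        (e ⊗ₜ[ℂ] exteriorPower.ιMulti ℂ (p + 1)
          (Matrix.vecCons ⁅x i.castSucc, x j.succ⁆ (j.removeNth (i.castSucc.removeNth x)))) := by
  simp [boundary, actionPart, bracketPart, AlternatingMap.alternatizeUncurryFin_apply, actionWedge,
    twistedAction, TensorProduct.sub_tmul, TensorProduct.smul_tmul',
    exteriorPower.alternatingMapLinearEquiv_apply_ιMulti, bracketSumAlt, bracketSum,
    TensorProduct.tmul_sum, -exteriorPower.ιMulti_apply_coe]

/-- The submodule of `q`-cycles of `(E ⊗ ⋀ L, d(f))`: the kernel of the boundary leaving degree `q`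
(everything for `q = 0`). -/
def cycles (ρ : RightAction L E) (f : Module.Dual ℂ L) :
    ∀ q : ℕ, Submodule ℂ (E ⊗[ℂ] ⋀[ℂ]^q L)
  | 0 => ⊤
  | q + 1 => LinearMap.ker (boundary ρ f q)

/-- The homology space `H_q(L, E ⊗ ℂ(f))`: the `q`-cycles modulo the `q`-boundaries. -/
abbrev Homology (ρ : RightAction L E) (f : Module.Dual ℂ L) (q : ℕ) : Type _ :=
  cycles ρ f q ⧸ (LinearMap.range (boundary ρ f q)).submoduleOf (cycles ρ f q)

/-- The joint spectrum `Sp(L, E)` of a Lie algebra `L` acting on the right on `E` through `ρ`: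
the characters `f` of `L` for which `H_*(L, E ⊗ ℂ(f))` is non-zero. -/
def Sp (ρ : RightAction L E) : Set (Module.Dual ℂ L) :=
  {f | (∀ x y : L, f ⁅x, y⁆ = 0) ∧ ∃ q : ℕ, Nontrivial (Homology ρ f q)}

end LieSpectrum

end

open scoped TensorProduct BoundedContinuousFunction
open Filter Topology

/-! There are two points: no non-zero character of `I` lies in the spectrum, and `0` does. Both rest
on a version of Lie's theorem for approximate eigenvectors.

A spectral value of `τ x` of maximal modulus is an approximate eigenvalue
(`exists_approx_eigenvalue`). Bounded sequences modulo null sequences turn approximate eigenvectors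
into genuine ones. There the usual weight argument works, with a factorial growth estimate in place
of the trace (`weight_lie_eq_zero`). For `x` in the derived ideal, the approximate weight on the
line of `x` can therefore be extended, through the lower central series, to all of `L`
(`IsApproxWeight.extend_top`). A weight of `L` kills commutators, so `τ x` is quasinilpotent and the
derived ideal has approximate joint null vectors.

If `f x ≠ 0`, quasinilpotence makes the twisted action of `x` invertible, while `ad x` is nilpotent
on the exterior powers. Hence the Lie derivative along `x` is invertible. By Cartan's formula it is
homotopic to zero, so all homology vanishes (`cycles_le_range_boundary`).

For `f = 0`, approximate null vectors of the dual action contradict the open mapping theorem if `E ·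
I = E`, so the homology in degree zero survives (`zero_mem_Sp_restrict`). -/

namespace LieSpectrum

/-! ### Approximate eigenvalues on the boundary of the spectral disc. -/

section ApproximateEigenvalue

variable {F : Type*} [NormedAddCommGroup F] [NormedSpace ℂ F] [CompleteSpace F]

/-- If `T - lam` is bounded below and `lam` is a limit of points of the resolvent set, then `lam`
lies in the resolvent set. -/
theorem notMem_spectrum_of_bounded_below (T : F →L[ℂ] F) (lam : ℂ) {c : ℝ} (hc : 0 < c)
    (hT : ∀ v, c * ‖v‖ ≤ ‖T v - lam • v‖)
    (hlam : ∀ δ > 0, ∃ μ, μ ∉ spectrum ℂ T ∧ ‖μ - lam‖ < δ) : lam ∉ spectrum ℂ T := by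
  -- Within distance `c / 2` of `lam`, the operator `μ - T` is bounded below by `c / 2`. Its inverse
  -- then has norm at most `2 / c`, and a Neumann series around `μ` reaches `lam`.
  obtain ⟨μ, hμ, hd⟩ := hlam (c / 2) (by positivity)
  rw [spectrum.notMem_iff] at hμ ⊢
  obtain ⟨U, hU⟩ := hμ
  have hUv : ∀ v, U.val v = μ • v - T v := fun v => by
    rw [hU]; simp [Algebra.algebraMap_eq_smul_one]
  have hbelow : ∀ v, c / 2 * ‖v‖ ≤ ‖U.val v‖ := fun v => by
    have h1 : T v - lam • v = (μ - lam) • v - U.val v := by rw [hUv]; module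
    have h2 := hT v
    rw [h1] at h2
    have h3 := norm_sub_le ((μ - lam) • v) (U.val v)
    rw [norm_smul] at h3
    nlinarith [norm_nonneg v]
  have hinv : ‖(U⁻¹).val‖ ≤ 2 / c := by
    refine ContinuousLinearMap.opNorm_le_bound _ (by positivity) fun v => ?_
    have h := hbelow ((U⁻¹).val v)
    have h' : U.val ((U⁻¹).val v) = v := by
      rw [← mul_apply_eq_comp, Units.mul_inv]; simp
    rw [h'] at h
    rw [div_mul_eq_mul_div, le_div_iff₀ hc]
    linarith
  have hsplit : algebraMap ℂ (F →L[ℂ] F) lam - T = U.val * (1 - (μ - lam) • (U⁻¹).val) := by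
    rw [mul_sub, mul_one, mul_smul_comm, Units.mul_inv, hU, Algebra.algebraMap_eq_smul_one,
      Algebra.algebraMap_eq_smul_one]
    module
  rw [hsplit]
  refine U.isUnit.mul (isUnit_one_sub_of_norm_lt_one ?_)
  rw [norm_smul]
  calc ‖μ - lam‖ * ‖(U⁻¹).val‖ ≤ ‖μ - lam‖ * (2 / c) := by gcongr
    _ < c / 2 * (2 / c) := by gcongr
    _ = 1 := by field_simp

/-- A point of the spectrum of maximal modulus is an approximate eigenvalue. -/
theorem exists_approx_eigenvalue [Nontrivial F] (T : F →L[ℂ] F) :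
    ∃ lam : ℂ, (∀ μ ∈ spectrum ℂ T, ‖μ‖ ≤ ‖lam‖) ∧
      ∀ ε > 0, ∃ v : F, v ≠ 0 ∧ ‖T v - lam • v‖ ≤ ε * ‖v‖ := by
  obtain ⟨lam, hmem, hmax⟩ := (spectrum.isCompact T).exists_isMaxOn (spectrum.nonempty T)
    continuous_norm.continuousOn
  refine ⟨lam, fun μ hμ => hmax hμ, fun ε hε => ?_⟩
  by_contra! hcon
  refine notMem_spectrum_of_bounded_below T lam hε (fun v => ?_) (fun δ hδ => ?_) hmem
  · by_cases hv : v = 0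
    · simp [hv]
    · exact (hcon v hv).le
  -- Points of modulus larger than `‖lam‖` are in the resolvent set: push `lam` radially outwards,
  -- or take any small non-zero number if `lam = 0`.
  · by_cases h0 : lam = 0
    · refine ⟨((δ / 2 : ℝ) : ℂ), fun h => ?_, ?_⟩
      · have := hmax h
        simp only [h0, Set.mem_ofPred_eq, norm_zero, Complex.norm_real, Real.norm_eq_abs,
          abs_of_pos (half_pos hδ)] at this
        linarith
      · rw [h0, sub_zero, Complex.norm_real, Real.norm_eq_abs, abs_of_pos (half_pos hδ)]
        linarith
    · have hn : 0 < ‖lam‖ := norm_pos_iff.mpr h0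
      set t : ℝ := δ / (2 * ‖lam‖) with ht
      have htpos : 0 < t := by positivity
      refine ⟨lam + (t : ℂ) * lam, fun h => ?_, ?_⟩
      · have h1 := hmax h
        have h2 : lam + (t : ℂ) * lam = ((1 + t : ℝ) : ℂ) * lam := by push_cast; ring
        simp only [Set.mem_ofPred_eq, h2, norm_mul, Complex.norm_real, Real.norm_eq_abs,
          abs_of_pos (by linarith : 0 < 1 + t)] at h1
        nlinarith
      · rw [add_sub_cancel_left, norm_mul, Complex.norm_real, Real.norm_eq_abs, abs_of_pos htpos,
          ht]
        have : δ / (2 * ‖lam‖) * ‖lam‖ = δ / 2 := by field_simp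
        rw [this]; linarith

end ApproximateEigenvalue

/-! ### Bounded sequences modulo null sequences. -/

section SequenceQuotient

variable (F : Type*) [NormedAddCommGroup F] [NormedSpace ℂ F]

/-- The bounded sequences that tend to zero. -/
def nullSequences : Submodule ℂ (ℕ →ᵇ F) where
  carrier := {u | Tendsto u atTop (𝓝 0)}
  add_mem' {u v} hu hv := by
    have h := Tendsto.add hu hv
    rw [add_zero] at h
    exact h
  zero_mem' := by
    change Tendsto (fun _ : ℕ => (0 : F)) atTop (𝓝 0)
    exact tendsto_const_nhds
  smul_mem' c u hu := by
    have h := Tendsto.const_smul hu c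
    rw [smul_zero] at h
    exact h

variable {F}

theorem mem_nullSequences {u : ℕ →ᵇ F} : u ∈ nullSequences F ↔ Tendsto u atTop (𝓝 0) := Iff.rfl

instance isClosed_nullSequences : IsClosed (nullSequences F : Set (ℕ →ᵇ F)) := by
  refine isClosed_of_closure_subset fun u hu => ?_
  rw [SetLike.mem_coe, mem_nullSequences, Metric.tendsto_atTop]
  intro ε hε
  obtain ⟨w, hw, hd⟩ := Metric.mem_closure_iff.mp hu (ε / 2) (by positivity)
  obtain ⟨N, hN⟩ := Metric.tendsto_atTop.mp (mem_nullSequences.mp hw) (ε / 2) (by positivity)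
  refine ⟨N, fun n hn => ?_⟩
  have h1 := hN n hn
  have h2 := (BoundedContinuousFunction.dist_coe_le_dist (f := u) (g := w) n).trans_lt hd
  linarith [dist_triangle (u n) (w n) 0]

variable (F) in
/-- Bounded sequences modulo null sequences. -/
abbrev SequenceQuotient : Type _ := (ℕ →ᵇ F) ⧸ nullSequences F

/-- The operator on `SequenceQuotient F` induced by termwise application of `T`. -/
noncomputable def extendOp (T : F →L[ℂ] F) : SequenceQuotient F →L[ℂ] SequenceQuotient F where
  toLinearMap := (nullSequences F).mapQ (nullSequences F)
    (T.compLeftContinuousBounded ℕ : (ℕ →ᵇ F) →L[ℂ] (ℕ →ᵇ F)).toLinearMap (by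
      intro u hu
      rw [Submodule.mem_comap, mem_nullSequences]
      have h := (T.continuous.tendsto 0).comp (mem_nullSequences.mp hu)
      rw [map_zero] at h
      exact h)
  cont := by
    refine (Submodule.isOpenQuotientMap_mkQ (nullSequences F)).isQuotientMap.continuous_iff.mpr ?_
    exact (nullSequences F).isOpenQuotientMap_mkQ.continuous.comp
      (T.compLeftContinuousBounded ℕ : (ℕ →ᵇ F) →L[ℂ] (ℕ →ᵇ F)).continuous

theorem extendOp_mk (T : F →L[ℂ] F) (u : ℕ →ᵇ F) :
    extendOp T (Submodule.Quotient.mk u) =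
      Submodule.Quotient.mk (T.compLeftContinuousBounded ℕ u) := rfl

/-- `extendOp` as a linear map. -/
noncomputable def extendOpₗ : (F →L[ℂ] F) →ₗ[ℂ] (SequenceQuotient F →L[ℂ] SequenceQuotient F) where
  toFun := extendOp
  map_add' S T := by
    ext w
    obtain ⟨u, rfl⟩ := Submodule.Quotient.mk_surjective _ w
    rfl
  map_smul' c T := by
    ext w
    obtain ⟨u, rfl⟩ := Submodule.Quotient.mk_surjective _ w
    rfl

theorem extendOp_mul (S T : F →L[ℂ] F) : extendOp (S * T) = extendOp S * extendOp T := by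
  ext w
  obtain ⟨u, rfl⟩ := Submodule.Quotient.mk_surjective _ w
  rfl

/-- The quotient norm is a limsup; this lemma and the next are its two halves. They carry estimates
in the quotient back to single terms of a sequence. -/
theorem frequently_lt_of_lt_norm_mk {u : ℕ →ᵇ F} {r : ℝ}
    (h : r < ‖(Submodule.Quotient.mk u : SequenceQuotient F)‖) : ∃ᶠ n in atTop, r < ‖u n‖ := by
  rw [Filter.Frequently]
  simp only [not_lt]
  intro hev
  obtain ⟨N, hN⟩ := eventually_atTop.mp hev
  have hr : 0 ≤ r := (norm_nonneg _).trans (hN N le_rfl)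
  -- Deleting the first `N` terms does not change the class and leaves a representative of norm at
  -- most `r`.
  let w : ℕ →ᵇ F := BoundedContinuousFunction.ofNormedAddCommGroupDiscrete
    (fun n => if n < N then 0 else u n) r (fun n => by
      split_ifs with hn
      · simpa using hr
      · exact hN n (not_lt.mp hn))
  have hw : ‖w‖ ≤ r := (BoundedContinuousFunction.norm_le hr).mpr fun n => by
    change ‖if n < N then 0 else u n‖ ≤ r
    split_ifs with hn
    · simpa using hr
    · exact hN n (not_lt.mp hn)
  have huw : (Submodule.Quotient.mk u : SequenceQuotient F) = Submodule.Quotient.mk w := by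
    rw [Submodule.Quotient.eq, mem_nullSequences]
    refine tendsto_const_nhds.congr' ?_
    filter_upwards [eventually_ge_atTop N] with n hn
    change 0 = u n - (if n < N then 0 else u n)
    simp [not_lt.mpr hn]
  rw [huw] at h
  exact absurd ((Submodule.Quotient.norm_mk_le (S := nullSequences F) w).trans hw) (not_le.mpr h)

theorem eventually_lt_of_norm_mk_lt {u : ℕ →ᵇ F} {r : ℝ}
    (h : ‖(Submodule.Quotient.mk u : SequenceQuotient F)‖ < r) : ∀ᶠ n in atTop, ‖u n‖ < r := by
  obtain ⟨w, hw, hlt⟩ := Submodule.Quotient.norm_mk_lt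
    (Submodule.Quotient.mk u : SequenceQuotient F) (sub_pos.mpr h)
  rw [add_sub_cancel] at hlt
  have huw : u - w ∈ nullSequences F := (Submodule.Quotient.eq _).mp hw.symm
  have htend : Tendsto (fun n => ‖u n - w n‖) atTop (𝓝 0) := by
    simpa using (mem_nullSequences.mp huw).norm
  filter_upwards [htend.eventually_lt_const (sub_pos.mpr hlt)] with n hn
  have h1 := w.norm_coe_le_norm n
  have h2 := norm_add_le (u n - w n) (w n)
  rw [sub_add_cancel] at h2
  linarith

end SequenceQuotient

/-! ### Weights vanish on brackets: Lie's lemma for bounded operators. -/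

section WeightVectors

variable {L : Type*} [LieRing L] [LieAlgebra ℂ L]
  {F : Type*} [NormedAddCommGroup F] [NormedSpace ℂ F]

/-- The span of `v, T v, …, T ^ (k - 1) v`. -/
def krylov (T : F →L[ℂ] F) (v : F) (k : ℕ) : Submodule ℂ F :=
  Submodule.span ℂ ((fun j => (T ^ j) v) '' Set.Iio k)

theorem pow_mem_krylov (T : F →L[ℂ] F) (v : F) {j k : ℕ} (h : j < k) :
    (T ^ j) v ∈ krylov T v k :=
  Submodule.subset_span ⟨j, h, rfl⟩

theorem krylov_mono (T : F →L[ℂ] F) (v : F) {j k : ℕ} (h : j ≤ k) :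
    krylov T v j ≤ krylov T v k :=
  Submodule.span_mono (Set.image_mono (Set.Iio_subset_Iio h))

theorem apply_mem_krylov (T : F →L[ℂ] F) (v : F) {k : ℕ} {w : F} (hw : w ∈ krylov T v k) :
    T w ∈ krylov T v (k + 1) := by
  induction hw using Submodule.span_induction with
  | mem w hw =>
    obtain ⟨j, hj, rfl⟩ := hw
    have := pow_mem_krylov T v (Nat.succ_lt_succ (Set.mem_Iio.mp hj))
    rwa [pow_succ', mul_apply_eq_comp] at this
  | zero => simp
  | add a b _ _ ha hb => rw [map_add]; exact add_mem ha hb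
  | smul c a _ ha => rw [map_smul]; exact Submodule.smul_mem _ c ha

variable {τ : L →ₗ[ℂ] (F →L[ℂ] F)} (hτ : ∀ x y : L, τ ⁅x, y⁆ = τ x * τ y - τ y * τ x)
  {J : Submodule ℂ L} {g : Module.Dual ℂ L} {v : F} (hv : ∀ z ∈ J, τ z v = g z • v)
  {y : L} (hy : ∀ z ∈ J, ⁅z, y⁆ ∈ J)

include hτ hv hy

/-- Moving `τ z` past `k + 1` factors `τ y` produces one term `g ⁅z, y⁆` per factor; iterated
brackets only contribute lower powers. -/
theorem weight_apply_pow_sub_mem (k : ℕ) : ∀ z ∈ J,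
    τ z ((τ y ^ (k + 1)) v) - g z • (τ y ^ (k + 1)) v - ((k + 1 : ℂ) * g ⁅z, y⁆) • (τ y ^ k) v
      ∈ krylov (τ y) v k := by
  have hcomm : ∀ z w, τ z (τ y w) = τ y (τ z w) + τ ⁅z, y⁆ w := fun z w => by
    rw [hτ]; simp
  induction k with
  | zero =>
    intro z hz
    simp [hcomm, hv z hz, hv _ (hy z hz)]
  | succ k ih =>
    intro z hz
    have h1 := apply_mem_krylov (τ y) v (ih z hz)
    have h2 := krylov_mono (τ y) v k.le_succ (ih _ (hy z hz))
    have h3 := Submodule.smul_mem _ ((k + 1 : ℂ) * g ⁅⁅z, y⁆, y⁆)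
      (pow_mem_krylov (τ y) v k.lt_succ_self)
    -- `h1` and `h2` are the inductive hypothesis for `z` and for `⁅z, y⁆`; `h3` absorbs the double
    -- bracket term, which is already of lower order.
    convert add_mem (add_mem h1 h2) h3 using 1
    have e : ∀ j, (τ y ^ (j + 1)) v = τ y ((τ y ^ j) v) := fun j => by rw [pow_succ']; rfl
    rw [e (k + 1), hcomm]
    simp only [map_sub, map_smul, ← e k]
    push_cast
    module

theorem weight_pow_apply_pow {z : L} (hz : z ∈ J) (k : ℕ) :
    (∀ w ∈ krylov (τ y) v k, ((τ z - g z • 1) ^ k) w = 0) ∧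
      ((τ z - g z • 1) ^ k) ((τ y ^ k) v) = ((k.factorial : ℂ) * g ⁅z, y⁆ ^ k) • v := by
  set S : F →L[ℂ] F := τ z - g z • 1 with hS
  have hSw : ∀ w, S w = τ z w - g z • w := fun w => by simp [hS]
  -- `S` lowers the Krylov filtration by one step, so only the leading coefficients `k, k - 1, …, 1`
  -- survive `k` applications; they multiply to `k!`.
  have hlower : ∀ k, ∀ w ∈ krylov (τ y) v (k + 1), S w ∈ krylov (τ y) v k := by
    intro k w hw
    induction hw using Submodule.span_induction with
    | mem w hw =>
      obtain ⟨j, hj, rfl⟩ := hw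
      rw [hSw]
      rcases j with _ | j
      · simp [hv z hz]
      · have h1 := krylov_mono (τ y) v (Nat.le_of_succ_le (Nat.lt_succ_iff.mp hj))
          (weight_apply_pow_sub_mem hτ hv hy j z hz)
        have h2 := Submodule.smul_mem _ ((j + 1 : ℂ) * g ⁅z, y⁆)
          (pow_mem_krylov (τ y) v (Nat.lt_of_succ_le (Nat.lt_succ_iff.mp hj)))
        simpa using add_mem h1 h2
    | zero => simp
    | add a b _ _ ha hb => rw [map_add]; exact add_mem ha hb
    | smul c a _ ha => rw [map_smul]; exact Submodule.smul_mem _ c ha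
  induction k with
  | zero => simp [krylov]
  | succ k ih =>
    refine ⟨fun w hw => ?_, ?_⟩
    · rw [pow_succ, mul_apply_eq_comp]
      exact ih.1 _ (hlower k w hw)
    · have h := ih.1 _ (weight_apply_pow_sub_mem hτ hv hy k z hz)
      rw [← hSw, map_sub, map_smul, ih.2, sub_eq_zero] at h
      rw [pow_succ, mul_apply_eq_comp, h, smul_smul, Nat.factorial_succ]
      push_cast
      congr 1
      ring

/-- Taking norms in `weight_pow_apply_pow` gives `k! ‖c‖ ^ k ≤ (‖S‖ ‖τ y‖) ^ k` for all `k`. The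
factorial outgrows every geometric sequence, so `c = 0`. -/
theorem weight_lie_eq_zero (hv0 : v ≠ 0) {z : L} (hz : z ∈ J) : g ⁅z, y⁆ = 0 := by
  by_contra hc
  set c := g ⁅z, y⁆ with hcdef
  set S : F →L[ℂ] F := τ z - g z • 1
  have hcn : 0 < ‖c‖ := norm_pos_iff.mpr hc
  have hvn : 0 < ‖v‖ := norm_pos_iff.mpr hv0
  have : Nontrivial F := ⟨v, 0, hv0⟩
  have hlim := FloorSemiring.tendsto_pow_div_factorial_atTop (‖S‖ * ‖τ y‖ / ‖c‖)
  obtain ⟨k, hk⟩ := (hlim.eventually_lt_const (zero_lt_one' ℝ)).exists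
  have h := congrArg norm (weight_pow_apply_pow hτ hv hy hz k).2
  rw [norm_smul, norm_mul, norm_pow, Complex.norm_natCast, ← hcdef] at h
  have h1 : ‖(S ^ k) ((τ y ^ k) v)‖ ≤ ‖S‖ ^ k * (‖τ y‖ ^ k * ‖v‖) :=
    (S ^ k).le_of_opNorm_le_of_le (norm_pow_le S k)
      ((τ y ^ k).le_of_opNorm_le (norm_pow_le _ k) v)
  rw [h, ← mul_assoc] at h1
  have h2 := le_of_mul_le_mul_right h1 hvn
  rw [div_pow, mul_pow, div_div, div_lt_one (by positivity), mul_comm (‖c‖ ^ k)] at hk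
  linarith

end WeightVectors

/-! ### Approximate weights and their extension. -/

section ApproximateWeights

variable {L : Type*} [LieRing L] [LieAlgebra ℂ L]
  {F : Type*} [NormedAddCommGroup F] [NormedSpace ℂ F]

/-- The functional `g` is an approximate joint eigenvalue of the operators `τ z`, `z ∈ J`. -/
def IsApproxWeight (τ : L →ₗ[ℂ] (F →L[ℂ] F)) (J : Submodule ℂ L) (g : Module.Dual ℂ L) : Prop :=
  ∀ s : Finset L, ↑s ⊆ (J : Set L) → ∀ ε > 0, ∃ v : F, v ≠ 0 ∧ ∀ z ∈ s, ‖τ z v - g z • v‖ ≤ ε * ‖v‖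

variable {τ : L →ₗ[ℂ] (F →L[ℂ] F)} {J : Submodule ℂ L} {g : Module.Dual ℂ L}

/-- The defect `τ z v - g z • v` is linear in `z`, so errors on a finite generating set control
those on any finite subset of the span. -/
theorem isApproxWeight_span {s : Finset L}
    (h : ∀ ε > 0, ∃ v : F, v ≠ 0 ∧ ∀ z ∈ s, ‖τ z v - g z • v‖ ≤ ε * ‖v‖) :
    IsApproxWeight τ (Submodule.span ℂ s) g := by
  have key : ∀ z ∈ Submodule.span ℂ (s : Set L), ∃ C : ℝ, 0 ≤ C ∧ ∀ δ ≥ 0, ∀ v : F,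
      (∀ a ∈ s, ‖τ a v - g a • v‖ ≤ δ * ‖v‖) → ‖τ z v - g z • v‖ ≤ C * δ * ‖v‖ := by
    intro z hz
    induction hz using Submodule.span_induction with
    | mem a ha => exact ⟨1, zero_le_one, fun δ _ v hv => by simpa using hv a ha⟩
    | zero => exact ⟨0, le_rfl, fun δ _ v _ => by simp⟩
    | add a b _ _ ha hb =>
      obtain ⟨A, hA0, hA⟩ := ha
      obtain ⟨B, hB0, hB⟩ := hb
      refine ⟨A + B, add_nonneg hA0 hB0, fun δ hδ v hv => ?_⟩
      have e : τ (a + b) v - g (a + b) • v = (τ a v - g a • v) + (τ b v - g b • v) := by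
        simp only [map_add, add_apply, add_smul]; abel
      rw [e, add_mul, add_mul]
      exact (norm_add_le _ _).trans (add_le_add (hA δ hδ v hv) (hB δ hδ v hv))
    | smul c a _ ha =>
      obtain ⟨A, hA0, hA⟩ := ha
      refine ⟨‖c‖ * A, by positivity, fun δ hδ v hv => ?_⟩
      have e : τ (c • a) v - g (c • a) • v = c • (τ a v - g a • v) := by
        simp only [map_smul, smul_apply, smul_sub, smul_smul, smul_eq_mul]
      rw [e, norm_smul, mul_assoc, mul_assoc, ← mul_assoc A]
      exact mul_le_mul_of_nonneg_left (hA δ hδ v hv) (norm_nonneg _)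
  choose! C hC0 hC using key
  intro t ht ε hε
  have hsum : 0 ≤ ∑ z ∈ t, C z := Finset.sum_nonneg fun z hz => hC0 z (ht hz)
  obtain ⟨v, hv0, hv⟩ := h (ε / (1 + ∑ z ∈ t, C z)) (by positivity)
  refine ⟨v, hv0, fun z hz => (hC z (ht hz) _ (by positivity) v hv).trans ?_⟩
  have hle : C z ≤ 1 + ∑ z ∈ t, C z :=
    (Finset.single_le_sum (fun i hi => hC0 i (ht hi)) hz).trans (by linarith)
  gcongr
  rw [← mul_div_assoc, div_le_iff₀ (by positivity)]
  nlinarith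

/-- Approximate weights become weights on the space of bounded sequences modulo null sequences. -/
theorem IsApproxWeight.exists_weight [FiniteDimensional ℂ L] (h : IsApproxWeight τ J g) :
    ∃ w : SequenceQuotient F, w ≠ 0 ∧ ∀ z ∈ J, extendOp (τ z) w = g z • w := by
  obtain ⟨s, hs⟩ := (inferInstance : IsNoetherian ℂ L).noetherian J
  have hsJ : (s : Set L) ⊆ J := hs ▸ Submodule.subset_span
  have hn : ∀ n : ℕ, ∃ v : F, ‖v‖ = 1 ∧ ∀ z ∈ s, ‖τ z v - g z • v‖ ≤ 1 / ((n : ℝ) + 1) := by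
    intro n
    obtain ⟨v, hv0, hv⟩ := h s hsJ (1 / ((n : ℝ) + 1)) (by positivity)
    have hvn : ‖v‖ ≠ 0 := norm_ne_zero_iff.mpr hv0
    refine ⟨((‖v‖⁻¹ : ℝ) : ℂ) • v, ?_, fun z hz => ?_⟩
    · rw [norm_smul, Complex.norm_real, norm_inv, norm_norm, inv_mul_cancel₀ hvn]
    · rw [map_smul, smul_comm (g z), ← smul_sub, norm_smul, Complex.norm_real, norm_inv, norm_norm,
        inv_mul_le_iff₀ (by positivity), mul_comm]
      exact hv z hz
  choose v hv1 hv using hn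
  let u : ℕ →ᵇ F := BoundedContinuousFunction.ofNormedAddCommGroupDiscrete v 1 (fun n => (hv1 n).le)
  refine ⟨Submodule.Quotient.mk u, fun h0 => ?_, fun z hz => ?_⟩
  · rw [Submodule.Quotient.mk_eq_zero, mem_nullSequences] at h0
    have h1 := h0.norm
    rw [norm_zero] at h1
    have h2 : (fun n => ‖u n‖) = fun _ => 1 := funext hv1
    rw [h2] at h1
    exact one_ne_zero (tendsto_nhds_unique tendsto_const_nhds h1)
  · rw [← hs] at hz
    induction hz using Submodule.span_induction with
    | mem z hz =>
      rw [extendOp_mk, ← Submodule.Quotient.mk_smul, Submodule.Quotient.eq, mem_nullSequences]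
      exact squeeze_zero_norm (fun n => hv n z hz) tendsto_one_div_add_atTop_nhds_zero_nat
    | zero =>
      have := map_zero (extendOpₗ (F := F))
      simp only [map_zero, zero_smul]
      exact congrArg (fun f : SequenceQuotient F →L[ℂ] SequenceQuotient F =>
        f (Submodule.Quotient.mk u)) this
    | add a b _ _ ha hb =>
      have := congrArg (fun f => f (Submodule.Quotient.mk u)) (map_add (extendOpₗ (F := F)) (τ a) (τ b))
      rw [map_add, map_add, add_smul, ← ha, ← hb]
      exact this
    | smul c a _ ha =>
      have := congrArg (fun f => f (Submodule.Quotient.mk u)) (map_smul (extendOpₗ (F := F)) c (τ a))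
      rw [map_smul, map_smul, smul_eq_mul, mul_smul, ← ha]
      exact this

variable [CompleteSpace F] (hτ : ∀ x y : L, τ ⁅x, y⁆ = τ x * τ y - τ y * τ x)

include hτ in
/-- An approximate weight of `J` extends to `J ⊔ span {y}` when `y` normalizes `J`. -/
theorem IsApproxWeight.extend_singleton [FiniteDimensional ℂ L] (h : IsApproxWeight τ J g) {y : L}
    (hy : ∀ z ∈ J, ⁅z, y⁆ ∈ J) (hyJ : y ∉ J) :
    ∃ g' : Module.Dual ℂ L, (∀ z ∈ J, g' z = g z) ∧
      IsApproxWeight τ (J ⊔ Submodule.span ℂ {y}) g' := by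
  classical
  obtain ⟨w₀, hw₀, hw₀J⟩ := h.exists_weight
  have hτ' : ∀ a b : L, (extendOpₗ ∘ₗ τ) ⁅a, b⁆ =
      (extendOpₗ ∘ₗ τ) a * (extendOpₗ ∘ₗ τ) b - (extendOpₗ ∘ₗ τ) b * (extendOpₗ ∘ₗ τ) a := by
    intro a b
    simp only [LinearMap.comp_apply, hτ, map_sub]
    exact congrArg₂ _ (extendOp_mul _ _) (extendOp_mul _ _)
  have hg : ∀ z ∈ J, g ⁅z, y⁆ = 0 := fun z hz =>
    weight_lie_eq_zero (τ := extendOpₗ ∘ₗ τ) hτ' hw₀J hy hw₀ hz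
  -- The joint eigenspace of `J` is closed and non-zero, and it is invariant under `τ y` because `g
  -- ⁅z, y⁆ = 0`. The approximate eigenvalue theorem thus applies to `τ y` on `W`.
  let W : Submodule ℂ (SequenceQuotient F) :=
    { carrier := {w | ∀ z ∈ J, extendOp (τ z) w = g z • w}
      add_mem' := fun {a b} ha hb z hz => by rw [map_add, ha z hz, hb z hz, smul_add]
      zero_mem' := fun z _ => by simp
      smul_mem' := fun c a ha z hz => by rw [map_smul, ha z hz, smul_comm] }
  have hWmem : ∀ w, w ∈ W ↔ ∀ z ∈ J, extendOp (τ z) w = g z • w := fun w => Iff.rfl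
  have hWclosed : IsClosed (W : Set (SequenceQuotient F)) := by
    have : (W : Set (SequenceQuotient F)) =
        ⋂ z ∈ J, {w | extendOp (τ z) w = g z • w} := by
      ext w; simp [hWmem]
    rw [this]
    exact isClosed_biInter fun z _ => isClosed_eq (extendOp (τ z)).continuous
      (continuous_const_smul (g z))
  have hWinv : ∀ w : W, extendOp (τ y) w ∈ W := by
    intro w z hz
    have h1 := congrArg (fun f => f (w : SequenceQuotient F)) (hτ' z y)
    change extendOp (τ ⁅z, y⁆) w = extendOp (τ z) (extendOp (τ y) w)
      - extendOp (τ y) (extendOp (τ z) w) at h1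
    rw [w.2 z hz, w.2 _ (hy z hz), hg z hz, zero_smul, map_smul] at h1
    exact (sub_eq_zero.mp h1.symm)
  have : CompleteSpace W := hWclosed.completeSpace_coe
  have : Nontrivial W := ⟨⟨⟨w₀, hw₀J⟩, 0, fun h => hw₀ (congrArg Subtype.val h)⟩⟩
  obtain ⟨μ, -, hμ⟩ := exists_approx_eigenvalue (F := W)
    (((extendOp (τ y)).comp W.subtypeL).codRestrict W hWinv)
  -- A multiple of `φ` corrects the value of `g` at `y` to `μ` without changing `g` on `J`.
  obtain ⟨φ, hφy, hφJ⟩ := Submodule.exists_le_ker_of_notMem hyJ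
  refine ⟨g + ((μ - g y) * (φ y)⁻¹) • φ, fun z hz => ?_, ?_⟩
  · have : φ z = 0 := hφJ hz
    simp [this]
  set g' : Module.Dual ℂ L := g + ((μ - g y) * (φ y)⁻¹) • φ with hg'
  have hg'y : g' y = μ := by simp [hg', hφy]
  have hg'J : ∀ z ∈ J, g' z = g z := fun z hz => by
    have : φ z = 0 := hφJ hz
    simp [hg', this]
  obtain ⟨s, hs⟩ := (inferInstance : IsNoetherian ℂ L).noetherian J
  have hsJ : (s : Set L) ⊆ J := hs ▸ Submodule.subset_span
  have hspan : J ⊔ Submodule.span ℂ {y} = Submodule.span ℂ ((insert y s : Finset L) : Set L) := by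
    rw [Finset.coe_insert, Submodule.span_insert, hs, sup_comm]
  rw [hspan]
  refine isApproxWeight_span fun ε hε => ?_
  -- The defects have norm below `ε / 2 * ‖w‖` for almost all terms, while infinitely many terms
  -- have norm above `‖w‖ / 2`; a common index gives the bound `ε`.
  obtain ⟨⟨w, hwW⟩, hw0, hw⟩ := hμ (ε / 4) (by positivity)
  have hw0' : w ≠ 0 := fun h => hw0 (Subtype.ext h)
  have hwn : 0 < ‖w‖ := norm_pos_iff.mpr hw0'
  change ‖extendOp (τ y) w - μ • w‖ ≤ ε / 4 * ‖w‖ at hw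
  obtain ⟨u, rfl⟩ := Submodule.Quotient.mk_surjective _ w
  set w : SequenceQuotient F := Submodule.Quotient.mk u with hwu
  have hall : ∀ z ∈ insert y s, ∀ᶠ n in atTop, ‖τ z (u n) - g' z • u n‖ < ε / 2 * ‖w‖ := by
    intro z hz
    have hlt : ‖(Submodule.Quotient.mk ((τ z).compLeftContinuousBounded ℕ u - g' z • u) :
        SequenceQuotient F)‖ < ε / 2 * ‖w‖ := by
      rw [Submodule.Quotient.mk_sub, Submodule.Quotient.mk_smul, ← extendOp_mk, ← hwu]
      rcases Finset.mem_insert.mp hz with rfl | hz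
      · rw [hg'y]
        nlinarith
      · rw [hg'J z (hsJ hz), hwW z (hsJ hz), sub_self, norm_zero]
        positivity
    exact eventually_lt_of_norm_mk_lt hlt
  obtain ⟨n, hn1, hn2⟩ := ((frequently_lt_of_lt_norm_mk (u := u) (half_lt_self hwn)).and_eventually
    ((Finset.eventually_all _).mpr hall)).exists
  have hnpos : 0 < ‖u n‖ := lt_trans (by positivity) hn1
  refine ⟨u n, norm_pos_iff.mp hnpos, fun z hz => (hn2 z hz).le.trans ?_⟩
  nlinarith

-- The bracket condition puts `⁅z, y⁆` in `J` for every `z` in an intermediate space, so vectors of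
-- `V` can be adjoined one at a time in any order. A maximal extension below `J ⊔ V` must be
-- everything.
include hτ in
theorem IsApproxWeight.extend_sup [FiniteDimensional ℂ L] (h : IsApproxWeight τ J g)
    {V : Submodule ℂ L} (hV : ∀ y ∈ V, ∀ z ∈ J ⊔ V, ⁅z, y⁆ ∈ J) :
    ∃ g' : Module.Dual ℂ L, (∀ z ∈ J, g' z = g z) ∧ IsApproxWeight τ (J ⊔ V) g' := by
  obtain ⟨K, ⟨hJK, hKV, g', hg', hK⟩, hmax⟩ := WellFounded.has_min
    (wellFounded_gt : WellFounded ((· > ·) : Submodule ℂ L → Submodule ℂ L → Prop))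
    {K | J ≤ K ∧ K ≤ J ⊔ V ∧ ∃ g' : Module.Dual ℂ L, (∀ z ∈ J, g' z = g z) ∧ IsApproxWeight τ K g'}
    ⟨J, le_rfl, le_sup_left, g, fun _ _ => rfl, h⟩
  by_cases hVK : V ≤ K
  · rw [le_antisymm hKV (sup_le hJK hVK)] at hK
    exact ⟨g', hg', hK⟩
  · obtain ⟨y, hyV, hyK⟩ := SetLike.not_le_iff_exists.mp hVK
    obtain ⟨g'', hg'', hK'⟩ := hK.extend_singleton hτ (y := y)
      (fun z hz => hJK (hV y hyV z (hKV hz))) hyK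
    refine absurd (?_ : K < K ⊔ Submodule.span ℂ {y}) (hmax _ ⟨hJK.trans le_sup_left,
      sup_le hKV ((Submodule.span_singleton_le_iff_mem _ _).mpr (le_sup_right (a := J) hyV)),
      g'', fun z hz => (hg'' z (hJK hz)).trans (hg' z hz), hK'⟩)
    refine lt_of_le_of_ne le_sup_left fun he => hyK ?_
    rw [he]
    exact le_sup_right (a := K) (Submodule.mem_span_singleton_self y)

end ApproximateWeights

/-! ### The derived ideal: nilpotence, quasinilpotence, approximate null vectors. -/

section DerivedIdeal

variable {L : Type*} [LieRing L] [LieAlgebra ℂ L]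

theorem eq_zero_of_mem_derived {M : Type*} [AddCommGroup M] [Module ℂ M] {φ : L →ₗ[ℂ] M}
    (hφ : ∀ a b : L, φ ⁅a, b⁆ = 0) {x : L} (hx : x ∈ ⁅(⊤ : LieIdeal ℂ L), (⊤ : LieIdeal ℂ L)⁆) :
    φ x = 0 := by
  rw [← LieSubmodule.mem_toSubmodule, LieSubmodule.lieIdeal_oper_eq_linear_span'] at hx
  have hle : Submodule.span ℂ {m | ∃ a ∈ (⊤ : LieIdeal ℂ L), ∃ b ∈ (⊤ : LieIdeal ℂ L), ⁅a, b⁆ = m}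
      ≤ LinearMap.ker φ := by
    rw [Submodule.span_le]
    rintro _ ⟨a, -, b, -, rfl⟩
    exact hφ a b
  exact hle hx

/-- Elements of the derived ideal of a solvable Lie algebra act nilpotently on finite-dimensional
modules. -/
theorem isNilpotent_toEnd_of_mem_derived [LieAlgebra.IsSolvable L] {V : Type*} [AddCommGroup V]
    [Module ℂ V] [FiniteDimensional ℂ V] [LieRingModule L V] [LieModule ℂ L V]
    {x : L} (hx : x ∈ ⁅(⊤ : LieIdeal ℂ L), (⊤ : LieIdeal ℂ L)⁆) :
    IsNilpotent (LieModule.toEnd ℂ L V x) := by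
  obtain ⟨U, hU, hmax⟩ := WellFounded.has_min
    (wellFounded_gt : WellFounded ((· > ·) : LieSubmodule ℂ L V → LieSubmodule ℂ L V → Prop))
    {U | ∀ u ∈ U, ∃ n, (LieModule.toEnd ℂ L V x ^ n) u = 0}
    ⟨⊥, fun u hu => ⟨0, by simpa using hu⟩⟩
  have htop : U = ⊤ := by
    by_contra hne
    have hne' : (U : Submodule ℂ V) ≠ ⊤ := fun h => hne (by
      rwa [← LieSubmodule.toSubmodule_eq_top])
    have : Nontrivial (V ⧸ U) := Submodule.Quotient.nontrivial_iff.mpr hne'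
    -- Lie's theorem gives a weight vector of `V ⧸ U`. Its weight kills commutators, so `x` sends a
    -- lift into `U`; adjoining the lift contradicts maximality.
    obtain ⟨χ, hχ⟩ := LieModule.exists_nontrivial_weightSpace_of_isSolvable ℂ L (V ⧸ U)
    obtain ⟨⟨m, hm⟩, hm0⟩ := exists_ne (0 : LieModule.weightSpace (V ⧸ U) χ)
    have hm0 : m ≠ 0 := fun h => hm0 (Subtype.ext h)
    rw [LieModule.mem_weightSpace] at hm
    have hχx : χ x = 0 := by
      refine eq_zero_of_mem_derived (fun a b => ?_) hx
      have h := hm ⁅a, b⁆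
      rw [lie_lie, hm b, hm a, lie_smul, lie_smul, hm a, hm b, smul_comm, sub_self] at h
      exact (smul_eq_zero.mp h.symm).resolve_right hm0
    obtain ⟨v, rfl⟩ := LieSubmodule.Quotient.surjective_mk' U m
    have hv : ∀ y : L, ⁅y, v⁆ - χ y • v ∈ U := fun y => by
      rw [← LieSubmodule.Quotient.mk_eq_zero, map_sub, map_smul, LieModuleHom.map_lie, hm y,
        sub_self]
    have hvU : v ∉ U := fun h => hm0 ((LieSubmodule.Quotient.mk_eq_zero U).mpr h)
    let U' : LieSubmodule ℂ L V :=
      { (U : Submodule ℂ V) ⊔ Submodule.span ℂ {v} with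
        lie_mem := by
          intro y m hm
          obtain ⟨u, hu, w, hw, rfl⟩ := Submodule.mem_sup.mp hm
          obtain ⟨c, rfl⟩ := Submodule.mem_span_singleton.mp hw
          have e : ⁅y, u + c • v⁆ = (⁅y, u⁆ + c • (⁅y, v⁆ - χ y • v)) + (c * χ y) • v := by
            rw [lie_add, lie_smul]; module
          rw [e]
          exact Submodule.add_mem_sup (add_mem (U.lie_mem hu) (U.smul_mem c (hv y)))
            (Submodule.smul_mem _ _ (Submodule.mem_span_singleton_self v)) }
    have hUU' : (U : Submodule ℂ V) ≤ (U' : Submodule ℂ V) :=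
      le_sup_left (b := Submodule.span ℂ {v})
    have hvU' : v ∈ (U' : Submodule ℂ V) :=
      le_sup_right (a := (U : Submodule ℂ V)) (Submodule.mem_span_singleton_self v)
    refine hmax U' (fun m hm => ?_) (lt_of_le_of_ne hUU' fun h => hvU ?_)
    · obtain ⟨u, hu, w, hw, rfl⟩ := Submodule.mem_sup.mp (show m ∈ (U : Submodule ℂ V) ⊔ _ from hm)
      obtain ⟨c, rfl⟩ := Submodule.mem_span_singleton.mp hw
      have hxm : LieModule.toEnd ℂ L V x (u + c • v) ∈ U := by
        have h := hv x
        rw [hχx, zero_smul, sub_zero] at h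
        rw [LieModule.toEnd_apply_apply, lie_add, lie_smul]
        exact add_mem (U.lie_mem hu) (U.smul_mem c h)
      obtain ⟨n, hn⟩ := hU _ hxm
      exact ⟨n + 1, by rw [pow_succ, Module.End.mul_apply, hn]⟩
    · rw [h]; exact hvU'
  rw [htop] at hU
  rw [Module.End.isNilpotent_iff_of_finite]
  exact fun m => hU m trivial

/-- The derived ideal of a solvable Lie algebra acts nilpotently on the algebra. -/
theorem exists_lcs_derived_eq_bot [FiniteDimensional ℂ L] [LieAlgebra.IsSolvable L] :
    ∃ k, (⁅(⊤ : LieIdeal ℂ L), (⊤ : LieIdeal ℂ L)⁆ : LieIdeal ℂ L).lcs L k = ⊥ := by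
  have h : LieModule.IsNilpotent (⁅(⊤ : LieIdeal ℂ L), (⊤ : LieIdeal ℂ L)⁆ : LieIdeal ℂ L) L :=
    (LieModule.isNilpotent_iff_forall' (R := ℂ)).mpr fun x =>
      isNilpotent_toEnd_of_mem_derived (L := L) (V := L) x.2
  obtain ⟨k, hk⟩ := (LieModule.isNilpotent_iff ℂ _ _).mp h
  refine ⟨k, ?_⟩
  rw [← LieSubmodule.toSubmodule_eq_bot, LieIdeal.coe_lcs_eq, hk]
  rfl

variable [FiniteDimensional ℂ L] [LieAlgebra.IsSolvable L]
  {F : Type*} [NormedAddCommGroup F] [NormedSpace ℂ F] [CompleteSpace F]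
  {τ : L →ₗ[ℂ] (F →L[ℂ] F)} (hτ : ∀ x y : L, τ ⁅x, y⁆ = τ x * τ y - τ y * τ x)

include hτ

/-- With `D` the derived ideal and `D.lcs L (k + 1) = [D, D.lcs L k]`, the weight climbs from the
line of `x` through the terms of this series, then to `D`, then to `L`. At each stage the brackets
with new vectors fall into the space already reached, as `x ∈ D`. -/
theorem IsApproxWeight.extend_top {x : L}
    (hx : x ∈ ⁅(⊤ : LieIdeal ℂ L), (⊤ : LieIdeal ℂ L)⁆) {g : Module.Dual ℂ L}
    (h : IsApproxWeight τ (Submodule.span ℂ {x}) g) :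
    ∃ g' : Module.Dual ℂ L, g' x = g x ∧ IsApproxWeight τ ⊤ g' := by
  set D : LieIdeal ℂ L := ⁅(⊤ : LieIdeal ℂ L), (⊤ : LieIdeal ℂ L)⁆ with hD
  have hxspan : x ∈ Submodule.span ℂ {x} := Submodule.mem_span_singleton_self x
  have hbr : ∀ a b : L, ⁅a, b⁆ ∈ D := fun a b =>
    LieSubmodule.lie_mem_lie (LieSubmodule.mem_top a) (LieSubmodule.mem_top b)
  have hspanD : Submodule.span ℂ {x} ≤ D.toSubmodule := by
    rw [Submodule.span_singleton_le_iff_mem]; exact hx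
  have hlie : ∀ k, ∀ a ∈ D, ∀ b ∈ D.lcs L k, ⁅b, a⁆ ∈ D.lcs L (k + 1) := fun k a ha b hb => by
    rw [← lie_skew, LieIdeal.lcs_succ]
    exact neg_mem (LieSubmodule.lie_mem_lie ha hb)
  have hlcsD : ∀ k, ((D.lcs L (k + 1)).toSubmodule : Submodule ℂ L) ≤ D.toSubmodule := fun k => by
    rw [LieIdeal.lcs_succ]
    exact LieSubmodule.lie_le_left D (D.lcs L k)
  have hlcs1 : ∃ g' : Module.Dual ℂ L, g' x = g x ∧
      IsApproxWeight τ (Submodule.span ℂ {x} ⊔ (D.lcs L 1).toSubmodule) g' := by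
    obtain ⟨k, hk⟩ := exists_lcs_derived_eq_bot (L := L)
    have hk1 : D.lcs L (k + 1) = ⊥ := by rw [LieIdeal.lcs_succ, hk, LieSubmodule.lie_bot]
    -- Induction from the zero term `k + 1` of the series down to the term `1`.
    have key : ∀ j, j ≤ k → ∃ g' : Module.Dual ℂ L, g' x = g x ∧
        IsApproxWeight τ (Submodule.span ℂ {x} ⊔ (D.lcs L (k - j + 1)).toSubmodule) g' := by
      intro j
      induction j with
      | zero =>
        intro _
        refine ⟨g, rfl, ?_⟩
        rw [Nat.sub_zero, hk1, LieSubmodule.bot_toSubmodule, sup_bot_eq]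
        exact h
      | succ j ih =>
        intro hj
        obtain ⟨g', hg', h'⟩ := ih (Nat.le_of_succ_le hj)
        obtain ⟨i, hi⟩ : ∃ i, k - j = i + 1 := ⟨k - j - 1, by omega⟩
        rw [hi] at h'
        rw [show k - (j + 1) + 1 = i + 1 by omega]
        obtain ⟨g'', hg'', h''⟩ := h'.extend_sup hτ (V := (D.lcs L (i + 1)).toSubmodule)
          (fun y hy z hz => by
            have hzD : z ∈ D := sup_le (sup_le hspanD (hlcsD _)) (hlcsD _) hz
            rw [← lie_skew]
            exact neg_mem (le_sup_right (a := Submodule.span ℂ {x}) (hlie _ z hzD y hy)))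
        refine ⟨g'', (hg'' x (le_sup_left (b := (D.lcs L _).toSubmodule) hxspan)).trans hg', ?_⟩
        rwa [sup_assoc, sup_eq_right.mpr (?_ : (D.lcs L (i + 1 + 1)).toSubmodule ≤ _)] at h''
        rw [LieIdeal.lcs_succ]
        exact LieSubmodule.lie_le_right _ _
    simpa using key k le_rfl
  obtain ⟨g₁, hg₁, h₁⟩ := hlcs1
  obtain ⟨g₂, hg₂, h₂⟩ := h₁.extend_sup hτ (V := D.toSubmodule) (fun y hy z hz => by
    exact le_sup_right (a := Submodule.span ℂ {x})
      (hlie 0 y hy z (LieSubmodule.mem_top z)))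
  obtain ⟨g₃, hg₃, h₃⟩ := h₂.extend_sup hτ (V := ⊤) (fun y _ z _ =>
    le_sup_right (b := D.toSubmodule) (hbr z y))
  rw [sup_top_eq] at h₃
  have hx1 : x ∈ Submodule.span ℂ {x} ⊔ (D.lcs L 1).toSubmodule :=
    le_sup_left (b := (D.lcs L 1).toSubmodule) hxspan
  refine ⟨g₃, ?_, h₃⟩
  rw [hg₃ x (le_sup_left (b := D.toSubmodule) hx1), hg₂ x hx1, hg₁]

omit [CompleteSpace F] [LieAlgebra.IsSolvable L] in
theorem IsApproxWeight.eq_zero_of_mem_derived {g : Module.Dual ℂ L} (h : IsApproxWeight τ ⊤ g)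
    {x : L} (hx : x ∈ ⁅(⊤ : LieIdeal ℂ L), (⊤ : LieIdeal ℂ L)⁆) : g x = 0 := by
  obtain ⟨w, hw0, hw⟩ := h.exists_weight
  refine LieSpectrum.eq_zero_of_mem_derived (fun a b => ?_) hx
  have h1 := hw ⁅a, b⁆ trivial
  have h2 : extendOp (τ ⁅a, b⁆) w = extendOp (τ a) (extendOp (τ b) w)
      - extendOp (τ b) (extendOp (τ a) w) := by
    rw [hτ]
    have := congrArg (fun f : SequenceQuotient F →L[ℂ] SequenceQuotient F => f w)
      (map_sub (extendOpₗ (F := F)) (τ a * τ b) (τ b * τ a))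
    refine this.trans ?_
    exact congrArg₂ (fun S T : SequenceQuotient F →L[ℂ] SequenceQuotient F => S w - T w)
      (extendOp_mul (τ a) (τ b)) (extendOp_mul (τ b) (τ a))
  rw [h2, hw b trivial, hw a trivial, map_smul, map_smul, hw b trivial, hw a trivial, smul_comm,
    sub_self] at h1
  exact (smul_eq_zero.mp h1.symm).resolve_right hw0

/-- An approximate eigenvalue of maximal modulus of `τ x` comes from an approximate weight. -/
theorem exists_isApproxWeight_top [Nontrivial F] {x : L}
    (hx : x ∈ ⁅(⊤ : LieIdeal ℂ L), (⊤ : LieIdeal ℂ L)⁆) (hx0 : x ≠ 0) :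
    ∃ g : Module.Dual ℂ L, (∀ μ ∈ spectrum ℂ (τ x), ‖μ‖ ≤ ‖g x‖) ∧ IsApproxWeight τ ⊤ g := by
  obtain ⟨lam, hmax, hlam⟩ := exists_approx_eigenvalue (τ x)
  obtain ⟨φ, hφ, -⟩ := Submodule.exists_le_ker_of_notMem (p := (⊥ : Submodule ℂ L)) (v := x)
    (by simpa using hx0)
  have hg : ((lam * (φ x)⁻¹) • φ) x = lam := by simp [hφ]
  have h : IsApproxWeight τ (Submodule.span ℂ {x}) ((lam * (φ x)⁻¹) • φ) := by
    rw [← Finset.coe_singleton]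
    refine isApproxWeight_span fun ε hε => ?_
    obtain ⟨v, hv0, hv⟩ := hlam ε hε
    refine ⟨v, hv0, fun z hz => ?_⟩
    rw [Finset.mem_singleton.mp hz, hg]
    exact hv
  obtain ⟨g', hg', h'⟩ := h.extend_top hτ hx
  exact ⟨g', by rwa [hg', hg], h'⟩

/-- The derived ideal acts by quasinilpotent operators. -/
theorem isUnit_sub_smul_of_mem_derived {x : L}
    (hx : x ∈ ⁅(⊤ : LieIdeal ℂ L), (⊤ : LieIdeal ℂ L)⁆) {c : ℂ} (hc : c ≠ 0) :
    IsUnit (τ x - c • (1 : F →L[ℂ] F)) := by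
  cases subsingleton_or_nontrivial F
  · rw [Subsingleton.elim (τ x - c • (1 : F →L[ℂ] F)) 1]
    exact isUnit_one
  by_cases hx0 : x = 0
  · rw [hx0, map_zero, zero_sub, IsUnit.neg_iff]
    exact (isUnit_one).smul (Units.mk0 c hc)
  obtain ⟨g, hmax, hg⟩ := exists_isApproxWeight_top hτ hx hx0
  by_contra hcon
  have hmem : c ∈ spectrum ℂ (τ x) := by
    rw [spectrum.mem_iff, ← IsUnit.neg_iff, neg_sub, Algebra.algebraMap_eq_smul_one]
    exact hcon
  have := hmax c hmem
  rw [hg.eq_zero_of_mem_derived hτ hx, norm_zero] at this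
  exact hc (norm_le_zero_iff.mp this)

/-- The derived ideal has approximate joint null vectors. -/
theorem exists_approx_null_vector [Nontrivial F] {s : Finset L}
    (hs : ∀ z ∈ s, z ∈ ⁅(⊤ : LieIdeal ℂ L), (⊤ : LieIdeal ℂ L)⁆) {ε : ℝ} (hε : 0 < ε) :
    ∃ v : F, v ≠ 0 ∧ ∀ z ∈ s, ‖τ z v‖ ≤ ε * ‖v‖ := by
  by_cases h0 : ∀ z ∈ s, z = 0
  · obtain ⟨v, hv⟩ := exists_ne (0 : F)
    refine ⟨v, hv, fun z hz => ?_⟩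
    rw [h0 z hz, map_zero]
    simpa using by positivity
  · push Not at h0
    -- Any non-zero `x` serves as a starting line: the resulting weight of `L` vanishes on the whole
    -- derived ideal.
    obtain ⟨x, hxs, hx0⟩ := h0
    obtain ⟨g, -, hg⟩ := exists_isApproxWeight_top hτ (hs x hxs) hx0
    obtain ⟨v, hv0, hv⟩ := hg s (fun _ _ => trivial) ε hε
    refine ⟨v, hv0, fun z hz => ?_⟩
    have := hv z hz
    rwa [hg.eq_zero_of_mem_derived hτ (hs z hz), zero_smul, sub_zero] at this

end DerivedIdeal

/-! ### Homology in degree zero for the zero character. -/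

section DegreeZero

variable {L : Type*} [LieRing L] [LieAlgebra ℂ L]
  {E : Type*} [NormedAddCommGroup E] [NormedSpace ℂ E]

/-- The left action on the dual space that is adjoint to a right action. -/
noncomputable def RightAction.dualOp (ρ : RightAction L E) :
    L →ₗ[ℂ] ((E →L[ℂ] ℂ) →L[ℂ] (E →L[ℂ] ℂ)) :=
  (ContinuousLinearMap.compL ℂ E E ℂ).flip.toLinearMap ∘ₗ ρ.op

theorem RightAction.dualOp_apply (ρ : RightAction L E) (x : L) (φ : E →L[ℂ] ℂ) (e : E) :
    ρ.dualOp x φ e = φ (ρ.op x e) := rfl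

/-- Transposition reverses products, so the right action becomes a left representation, to which the
results on weights apply. -/
theorem RightAction.dualOp_lie (ρ : RightAction L E) (x y : L) :
    ρ.dualOp ⁅x, y⁆ = ρ.dualOp x * ρ.dualOp y - ρ.dualOp y * ρ.dualOp x := by
  ext φ e
  simp [RightAction.dualOp_apply, ρ.op_lie]

variable [FiniteDimensional ℂ L] [LieAlgebra.IsSolvable L] [CompleteSpace E] [Nontrivial E]

/-- `E · I ≠ E` for every finite family of elements of the derived ideal. -/
theorem not_surjective_sum_op (ρ : RightAction L E) {n : ℕ} (b : Fin n → L)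
    (hb : ∀ i, b i ∈ ⁅(⊤ : LieIdeal ℂ L), (⊤ : LieIdeal ℂ L)⁆) :
    ¬ Function.Surjective fun u : Fin n → E => ∑ i, ρ.op (b i) (u i) := by
  classical
  intro hsurj
  let Φ : (Fin n → E) →L[ℂ] E := ∑ i, (ρ.op (b i)).comp (ContinuousLinearMap.proj i)
  have hΦ : ∀ u, Φ u = ∑ i, ρ.op (b i) (u i) := fun u => by simp [Φ]
  obtain ⟨C, hC, hpre⟩ := Φ.exists_preimage_norm_le fun e => by
    obtain ⟨u, hu⟩ := hsurj e
    exact ⟨u, (hΦ u).trans hu⟩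
  -- With preimages bounded by `C`, this `ε` forces `‖φ‖ ≤ n C / (2 (n C + 1)) * ‖φ‖`, which is
  -- impossible for `φ ≠ 0`.
  obtain ⟨φ, hφ0, hφ⟩ := exists_approx_null_vector ρ.dualOp_lie (s := Finset.univ.image b)
    (by simpa using hb) (ε := 1 / (2 * (n * C + 1))) (by positivity)
  have hle : ‖φ‖ ≤ n * (1 / (2 * (n * C + 1)) * ‖φ‖ * C) := by
    refine φ.opNorm_le_bound (by positivity) fun e => ?_
    obtain ⟨u, rfl, hu⟩ := hpre e
    conv_lhs => rw [hΦ, map_sum]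
    refine (norm_sum_le _ _).trans ?_
    have hterm : ∀ i ∈ Finset.univ, ‖φ (ρ.op (b i) (u i))‖ ≤
        1 / (2 * (n * C + 1)) * ‖φ‖ * C * ‖Φ u‖ := fun i _ => by
      rw [← RightAction.dualOp_apply, mul_assoc _ C]
      exact (ρ.dualOp (b i) φ).le_of_opNorm_le_of_le (hφ _ (by simp))
        ((norm_le_pi_norm u i).trans hu)
    refine (Finset.sum_le_card_nsmul _ _ _ hterm).trans (le_of_eq ?_)
    rw [Finset.card_univ, Fintype.card_fin, nsmul_eq_mul, mul_assoc (n : ℝ)]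
  have hpos : 0 < ‖φ‖ := norm_pos_iff.mpr hφ0
  have h1 : n * (1 / (2 * (n * C + 1)) * ‖φ‖ * C) = (n * C) / (2 * (n * C + 1)) * ‖φ‖ := by
    field_simp
  rw [h1] at hle
  have h2 : (n * C) / (2 * (n * C + 1)) < 1 := by
    rw [div_lt_one (by positivity)]
    have : 0 ≤ n * C := by positivity
    linarith
  nlinarith

/-- The homology in degree zero is `E` modulo `E · I`, and `E · I` is the range of the sum of the
operators of a basis of `I`. -/
theorem zero_mem_Sp_restrict (ρ : RightAction L E) (I : LieIdeal ℂ L)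
    (hI : I ≤ ⁅(⊤ : LieIdeal ℂ L), (⊤ : LieIdeal ℂ L)⁆) : 0 ∈ Sp (ρ.restrict I) := by
  refine ⟨fun _ _ => rfl, 0, ?_⟩
  rw [Homology, Submodule.Quotient.nontrivial_iff]
  intro htop
  let b := Module.finBasis ℂ I
  have hsurj := not_surjective_sum_op ρ (fun i => (b i : L)) fun i => hI (b i).2
  let R : Submodule ℂ E := LinearMap.range
    (∑ i, (ρ.op (b i)).toLinearMap ∘ₗ LinearMap.proj i : (Fin _ → E) →ₗ[ℂ] E)
  have hR : ∀ (x : I) (e : E), (ρ.restrict I).op x e ∈ R := fun x e => by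
    refine ⟨fun i => b.repr x i • e, ?_⟩
    have hop : ∀ z : I, ρ.op (z : L) = (ρ.restrict I).op z := fun _ => rfl
    conv_rhs => rw [← b.sum_repr x, map_sum]
    simp [hop]
  let κ : E ⊗[ℂ] ⋀[ℂ]^0 I →ₗ[ℂ] E := (TensorProduct.rid ℂ E).toLinearMap ∘ₗ
    (exteriorPower.zeroEquiv (R := ℂ) (M := I)).toLinearMap.lTensor E
  have hκ : ∀ t, κ (boundary (ρ.restrict I) 0 0 t) ∈ R := by
    intro t
    induction t with
    | zero => simp
    | add s t hs ht => rw [map_add, map_add]; exact add_mem hs ht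
    | tmul e w =>
      have hw : w ∈ Submodule.span ℂ (Set.range (exteriorPower.ιMulti ℂ 1 (M := I))) := by
        rw [exteriorPower.ιMulti_span]; trivial
      induction hw using Submodule.span_induction with
      | mem w hw =>
        obtain ⟨x, rfl⟩ := hw
        rw [boundary_zero_tmul]
        have h := hR (x 0) e
        simpa [κ, -exteriorPower.ιMulti_apply_coe] using h
      | zero => simp
      | add a b _ _ ha hb => rw [TensorProduct.tmul_add, map_add, map_add]; exact add_mem ha hb
      | smul c a _ ha =>
        rw [TensorProduct.tmul_smul, map_smul, map_smul]; exact Submodule.smul_mem _ c ha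
  refine hsurj fun e => ?_
  have hmem : (⟨e ⊗ₜ exteriorPower.ιMulti ℂ 0 ![], trivial⟩ : cycles (ρ.restrict I) 0 0) ∈
      (LinearMap.range (boundary (ρ.restrict I) 0 0)).submoduleOf (cycles (ρ.restrict I) 0 0) := by
    rw [htop]; trivial
  obtain ⟨t, ht⟩ := hmem
  have h := hκ t
  rw [ht] at h
  obtain ⟨u, hu⟩ := h
  refine ⟨u, ?_⟩
  simpa [κ, -exteriorPower.ιMulti_apply_coe] using hu

end DegreeZero

/-! ### The derivation of the exterior algebra induced by `ad x`. -/

section ExteriorDerivation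

variable {M : Type*} [LieRing M] [LieAlgebra ℂ M]

/-- Left exterior multiplication `w ↦ z ∧ w`. -/
noncomputable def wedge (p : ℕ) : M →ₗ[ℂ] ⋀[ℂ]^p M →ₗ[ℂ] ⋀[ℂ]^(p + 1) M :=
  exteriorPower.alternatingMapLinearEquiv.toLinearMap ∘ₗ wedgeLeft M p

theorem wedge_ιMulti (p : ℕ) (z : M) (v : Fin p → M) :
    wedge p z (exteriorPower.ιMulti ℂ p v) =
      exteriorPower.ιMulti ℂ (p + 1) (Matrix.vecCons z v) := by
  simp [wedge, wedgeLeft, exteriorPower.alternatingMapLinearEquiv_apply_ιMulti,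
    -exteriorPower.ιMulti_apply_coe]

theorem ιMulti_vecCons_vecCons_swap (p : ℕ) (y z : M) (v : Fin p → M) :
    exteriorPower.ιMulti ℂ (p + 2) (Matrix.vecCons y (Matrix.vecCons z v)) =
      -exteriorPower.ιMulti ℂ (p + 2) (Matrix.vecCons z (Matrix.vecCons y v)) := by
  rw [← AlternatingMap.map_swap _ _ (show (0 : Fin (p + 2)) ≠ 1 by simp)]
  congr 1
  ext i
  refine Fin.cases ?_ (fun i => Fin.cases ?_ (fun i => ?_) i) i
  · simp
  · simp
  · rw [Function.comp_apply, Equiv.swap_apply_of_ne_of_ne (by simp [Fin.ext_iff])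
      (by simp [Fin.ext_iff])]
    rfl

/-- Products `y ∧ w` span, so identities of operators can be proved by induction on the degree from
commutation rules with `wedge`. -/
theorem exteriorPower_ext {p : ℕ} {N : Type*} [AddCommGroup N] [Module ℂ N]
    {S T : ⋀[ℂ]^(p + 1) M →ₗ[ℂ] N} (h : ∀ y, S ∘ₗ wedge p y = T ∘ₗ wedge p y) : S = T := by
  refine exteriorPower.linearMap_ext (AlternatingMap.ext fun v => ?_)
  have := LinearMap.congr_fun (h (v 0)) (exteriorPower.ιMulti ℂ p (Matrix.vecTail v))
  rw [LinearMap.comp_apply, LinearMap.comp_apply, wedge_ιMulti,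
    show Matrix.vecCons (v 0) (Matrix.vecTail v) = v from Matrix.cons_head_tail v] at this
  exact this

/-- The derivation of the exterior algebra that extends `ad x`, in degree `p`. -/
noncomputable def adDerivation (x : M) : ∀ p : ℕ, ⋀[ℂ]^p M →ₗ[ℂ] ⋀[ℂ]^p M
  | 0 => 0
  | p + 1 => exteriorPower.alternatingMapLinearEquiv
      (AlternatingMap.alternatizeUncurryFin (wedgeLeft M p ∘ₗ (LieModule.toEnd ℂ M M x)))

theorem adDerivation_ιMulti (x : M) (p : ℕ) (v : Fin (p + 1) → M) :
    adDerivation x (p + 1) (exteriorPower.ιMulti ℂ (p + 1) v) =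
      ∑ l : Fin (p + 1), (-1 : ℤ) ^ (l : ℕ) •
        exteriorPower.ιMulti ℂ (p + 1) (Matrix.vecCons ⁅x, v l⁆ (l.removeNth v)) := by
  simp [adDerivation, exteriorPower.alternatingMapLinearEquiv_apply_ιMulti,
    AlternatingMap.alternatizeUncurryFin_apply, wedgeLeft, -exteriorPower.ιMulti_apply_coe]

theorem removeNth_succ_vecCons {α : Type*} {p : ℕ} (y : α) (v : Fin (p + 1) → α) (l : Fin (p + 1)) :
    l.succ.removeNth (Matrix.vecCons y v) = (Matrix.vecCons y (l.removeNth v) : Fin (p + 1) → α) := by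
  ext i
  refine Fin.cases ?_ (fun i => ?_) i
  · simp [Fin.removeNth]
  · simp [Fin.removeNth]

theorem removeNth_zero_vecCons {α : Type*} {p : ℕ} (y : α) (v : Fin p → α) :
    (0 : Fin (p + 1)).removeNth (Matrix.vecCons y v) = v := by
  ext i
  simp [Fin.removeNth]

theorem adDerivation_comp_wedge (x y : M) (p : ℕ) :
    adDerivation x (p + 1) ∘ₗ wedge p y = wedge p ⁅x, y⁆ + wedge p y ∘ₗ adDerivation x p := by
  refine exteriorPower.linearMap_ext (AlternatingMap.ext fun v => ?_)
  simp only [LinearMap.compAlternatingMap_apply, LinearMap.comp_apply, LinearMap.add_apply,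
    wedge_ιMulti, adDerivation_ιMulti, Fin.sum_univ_succ]
  rw [removeNth_zero_vecCons]
  cases p with
  | zero => simp [adDerivation, -exteriorPower.ιMulti_apply_coe]
  | succ p =>
    simp only [Fin.val_zero, pow_zero, one_smul, Matrix.cons_val_zero, Matrix.cons_val_succ,
      removeNth_succ_vecCons, adDerivation_ιMulti, map_sum, map_zsmul, wedge_ιMulti, Fin.val_succ]
    congr 1
    refine Finset.sum_congr rfl fun l _ => ?_
    rw [ιMulti_vecCons_vecCons_swap, pow_succ]
    simp

theorem sum_ge_eq_sum_ite {N : Type*} [AddCommMonoid N] {q : ℕ} (i : Fin q) (F : Fin q → N) :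
    ∑ j ≥ i, F j = ∑ j, if i ≤ j then F j else 0 := by
  rw [← Finset.sum_filter]
  congr 1
  ext j
  simp

/-- Cartan's formula for trivial coefficients: pairs containing the new first vector `y` give `-ad
y`; in the other pairs `y` is moved past the bracket, at the cost of a sign. -/
theorem bracketPart_comp_wedge (y : M) (p : ℕ) :
    bracketPart M (p + 1) ∘ₗ wedge (p + 1) y =
      -adDerivation y (p + 1) - wedge p y ∘ₗ bracketPart M p := by
  refine exteriorPower.linearMap_ext (AlternatingMap.ext fun v => ?_)
  have hb : ∀ q (v : Fin (q + 2) → M), bracketPart M (q + 1) (exteriorPower.ιMulti ℂ (q + 2) v) =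
      bracketSum q v := fun q v =>
    exteriorPower.alternatingMapLinearEquiv_apply_ιMulti _ _
  simp only [LinearMap.compAlternatingMap_apply, LinearMap.comp_apply, LinearMap.sub_apply,
    LinearMap.neg_apply, wedge_ιMulti, adDerivation_ιMulti, hb, bracketSum]
  rw [Fin.sum_univ_succ, sub_eq_add_neg]
  congr 1
  · rw [sum_ge_eq_sum_ite, ← Finset.sum_neg_distrib]
    refine Finset.sum_congr rfl fun j _ => ?_
    rw [if_pos (Fin.zero_le j), Fin.castSucc_zero, removeNth_zero_vecCons]
    simp [pow_succ, -exteriorPower.ιMulti_apply_coe]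
  · cases p with
    | zero => simp [bracketPart]
    | succ p =>
      rw [hb, bracketSum, map_sum, ← Finset.sum_neg_distrib]
      refine Finset.sum_congr rfl fun i _ => ?_
      rw [sum_ge_eq_sum_ite, Fin.sum_univ_succ, if_neg (by simp), zero_add, map_sum]
      rw [sum_ge_eq_sum_ite, ← Finset.sum_neg_distrib]
      refine Finset.sum_congr rfl fun j _ => ?_
      simp only [Fin.succ_le_succ_iff]
      split_ifs with hij
      · rw [← Fin.succ_castSucc, removeNth_succ_vecCons, removeNth_succ_vecCons, map_zsmul,
          wedge_ιMulti, ιMulti_vecCons_vecCons_swap]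
        simp [pow_succ, pow_add, -exteriorPower.ιMulti_apply_coe]
      · simp

theorem adDerivation_lie (x y : M) (p : ℕ) :
    adDerivation x p ∘ₗ adDerivation y p - adDerivation y p ∘ₗ adDerivation x p =
      adDerivation ⁅x, y⁆ p := by
  induction p with
  | zero => exact sub_self (adDerivation x 0 ∘ₗ adDerivation y 0)
  | succ p ih =>
    refine exteriorPower_ext fun z => ?_
    have h := adDerivation_comp_wedge (M := M) (p := p)
    have e : ∀ a b, (adDerivation a (p + 1) ∘ₗ adDerivation b (p + 1)) ∘ₗ wedge p z =
        wedge p ⁅a, ⁅b, z⁆⁆ + wedge p ⁅b, z⁆ ∘ₗ adDerivation a p + (wedge p ⁅a, z⁆ ∘ₗ adDerivation b p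
          + wedge p z ∘ₗ (adDerivation a p ∘ₗ adDerivation b p)) := fun a b => by
      rw [LinearMap.comp_assoc, h, LinearMap.comp_add, h, ← LinearMap.comp_assoc, h,
        LinearMap.add_comp, LinearMap.comp_assoc]
    rw [LinearMap.sub_comp, e, e, h, ← ih, LinearMap.comp_sub, lie_lie, map_sub]
    abel

theorem isNilpotent_adDerivation {x : M} (hx : IsNilpotent (LieModule.toEnd ℂ M M x)) (p : ℕ) :
    IsNilpotent (adDerivation x p : Module.End ℂ (⋀[ℂ]^p M)) := by
  induction p with
  | zero => exact ⟨1, by rw [pow_one]; rfl⟩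
  | succ p ih =>
    -- `K` is a sum of commuting nilpotents, and the surjection `z ⊗ w ↦ z ∧ w` intertwines it with
    -- the derivation in degree `p + 1`.
    let K : Module.End ℂ (M ⊗[ℂ] ⋀[ℂ]^p M) :=
      (LieModule.toEnd ℂ M M x).rTensor _ + (adDerivation x p).lTensor M
    have hK : IsNilpotent K := by
      refine Commute.isNilpotent_add ?_ ?_ ?_
      · exact (LinearMap.rTensor_comp_lTensor _ _ _).trans
          (LinearMap.lTensor_comp_rTensor _ _ _).symm
      · exact hx.map (Module.End.rTensorAlgHom ℂ M (⋀[ℂ]^p M))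
      · exact ih.map (Module.End.lTensorAlgHom ℂ (⋀[ℂ]^p M) M)
    let B : M ⊗[ℂ] ⋀[ℂ]^p M →ₗ[ℂ] ⋀[ℂ]^(p + 1) M := TensorProduct.lift (wedge p)
    have hB : ∀ t, adDerivation x (p + 1) (B t) = B (K t) := by
      intro t
      induction t with
      | zero => simp
      | add s t hs ht => simp only [map_add, hs, ht]
      | tmul z w =>
        have := LinearMap.congr_fun (adDerivation_comp_wedge x z p) w
        simpa [B, K] using this
    obtain ⟨n, hn⟩ := hK
    have hBn : ∀ k t, ((adDerivation x (p + 1) : Module.End ℂ _) ^ k) (B t) = B ((K ^ k) t) := by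
      intro k
      induction k with
      | zero => simp
      | succ k ihk => intro t; rw [pow_succ, pow_succ, Module.End.mul_apply, hB, ihk]; rfl
    refine ⟨n, exteriorPower_ext fun y => LinearMap.ext fun w => ?_⟩
    have := hBn n (y ⊗ₜ w)
    rw [hn] at this
    simpa [B] using this

end ExteriorDerivation

/-! ### Cartan homotopy and vanishing of homology. -/

section Homotopy

variable {M : Type*} [LieRing M] [LieAlgebra ℂ M]
  {E : Type*} [NormedAddCommGroup E] [NormedSpace ℂ E]
  (ρ : RightAction M E) (f : Module.Dual ℂ M)

/-- The Lie derivative along `x` on `E ⊗ ⋀^p M`. -/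
noncomputable def lieDerivative (x : M) (p : ℕ) : Module.End ℂ (E ⊗[ℂ] ⋀[ℂ]^p M) :=
  (twistedAction ρ f x).rTensor _ - (adDerivation x p).lTensor E

/-- Exterior multiplication on `E ⊗ ⋀ M`. -/
noncomputable def tensorWedge (E : Type*) [NormedAddCommGroup E] [NormedSpace ℂ E] (p : ℕ) (y : M) :
    E ⊗[ℂ] ⋀[ℂ]^p M →ₗ[ℂ] E ⊗[ℂ] ⋀[ℂ]^(p + 1) M :=
  (wedge p y).lTensor E

theorem tensor_exteriorPower_ext {p : ℕ} {N : Type*} [AddCommGroup N] [Module ℂ N]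
    {S T : E ⊗[ℂ] ⋀[ℂ]^(p + 1) M →ₗ[ℂ] N}
    (h : ∀ y, S ∘ₗ tensorWedge E p y = T ∘ₗ tensorWedge E p y) : S = T := by
  refine TensorProduct.ext (LinearMap.ext fun e => exteriorPower_ext fun y => LinearMap.ext fun w => ?_)
  exact LinearMap.congr_fun (h y) (e ⊗ₜ w)

theorem actionPart_ιMulti (p : ℕ) (e : E) (v : Fin (p + 1) → M) :
    actionPart ρ f p (e ⊗ₜ exteriorPower.ιMulti ℂ (p + 1) v) =
      ∑ k : Fin (p + 1), (-1 : ℤ) ^ (k : ℕ) •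
        (twistedAction ρ f (v k) e ⊗ₜ[ℂ] exteriorPower.ιMulti ℂ p (k.removeNth v)) := by
  simp [actionPart, AlternatingMap.alternatizeUncurryFin_apply, actionWedge,
    exteriorPower.alternatingMapLinearEquiv_apply_ιMulti, -exteriorPower.ιMulti_apply_coe]

theorem tensor_ιMulti_ext {p : ℕ} {N : Type*} [AddCommGroup N] [Module ℂ N]
    {S T : E ⊗[ℂ] ⋀[ℂ]^p M →ₗ[ℂ] N}
    (h : ∀ e v, S (e ⊗ₜ exteriorPower.ιMulti ℂ p v) = T (e ⊗ₜ exteriorPower.ιMulti ℂ p v)) :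
    S = T :=
  TensorProduct.ext (LinearMap.ext fun e => exteriorPower.linearMap_ext
    (AlternatingMap.ext fun v => h e v))

theorem boundary_zero_comp_tensorWedge (y : M) :
    boundary ρ f 0 ∘ₗ tensorWedge E 0 y = lieDerivative ρ f y 0 := by
  refine tensor_ιMulti_ext fun e v => ?_
  have h1 : tensorWedge E 0 y (e ⊗ₜ exteriorPower.ιMulti ℂ 0 v) =
      e ⊗ₜ exteriorPower.ιMulti ℂ 1 (Matrix.vecCons y v) := by
    rw [tensorWedge, LinearMap.lTensor_tmul, wedge_ιMulti]
  rw [LinearMap.comp_apply, h1, boundary, LinearMap.add_apply, actionPart_ιMulti]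
  simp [lieDerivative, adDerivation, bracketPart, -exteriorPower.ιMulti_apply_coe]

/-- Cartan's formula with coefficients: exterior multiplication by `y` is a homotopy from the Lie
derivative along `y` to zero. -/
theorem boundary_succ_comp_tensorWedge (y : M) (p : ℕ) :
    boundary ρ f (p + 1) ∘ₗ tensorWedge E (p + 1) y =
      lieDerivative ρ f y (p + 1) - tensorWedge E p y ∘ₗ boundary ρ f p := by
  have hbr : (bracketPart M (p + 1)).lTensor E ∘ₗ tensorWedge E (p + 1) y =
      -(adDerivation y (p + 1)).lTensor E
        - tensorWedge E p y ∘ₗ (bracketPart M p).lTensor E := by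
    rw [tensorWedge, tensorWedge, ← LinearMap.lTensor_comp, ← LinearMap.lTensor_comp,
      bracketPart_comp_wedge, LinearMap.lTensor_sub, LinearMap.lTensor_neg]
  have hact : actionPart ρ f (p + 1) ∘ₗ tensorWedge E (p + 1) y =
      (twistedAction ρ f y).rTensor _ - tensorWedge E p y ∘ₗ actionPart ρ f p := by
    refine tensor_ιMulti_ext fun e v => ?_
    have hW : ∀ (q : ℕ) (e : E) (v : Fin q → M), tensorWedge E q y (e ⊗ₜ exteriorPower.ιMulti ℂ q v) =
        e ⊗ₜ exteriorPower.ιMulti ℂ (q + 1) (Matrix.vecCons y v) := fun q e v => by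
      rw [tensorWedge, LinearMap.lTensor_tmul, wedge_ιMulti]
    simp only [LinearMap.comp_apply, LinearMap.sub_apply, hW, actionPart_ιMulti,
      LinearMap.rTensor_tmul, map_sum, map_zsmul]
    rw [Fin.sum_univ_succ, removeNth_zero_vecCons, sub_eq_add_neg, ← Finset.sum_neg_distrib]
    congr 1
    · simp
    · refine Finset.sum_congr rfl fun k _ => ?_
      rw [removeNth_succ_vecCons, Fin.val_succ, pow_succ]
      simp
  rw [boundary, LinearMap.add_comp, hbr, hact, boundary, LinearMap.comp_add, lieDerivative]
  abel

theorem lieDerivative_comp_tensorWedge (x y : M) (p : ℕ) :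
    lieDerivative ρ f x (p + 1) ∘ₗ tensorWedge E p y =
      tensorWedge E p y ∘ₗ lieDerivative ρ f x p - tensorWedge E p ⁅x, y⁆ := by
  rw [lieDerivative, lieDerivative, tensorWedge, tensorWedge, LinearMap.sub_comp, LinearMap.comp_sub,
    ← LinearMap.lTensor_comp, ← LinearMap.lTensor_comp, adDerivation_comp_wedge,
    LinearMap.lTensor_add, LinearMap.rTensor_comp_lTensor, LinearMap.lTensor_comp_rTensor]
  abel

variable {f} (hf : ∀ x y : M, f ⁅x, y⁆ = 0)

include hf

theorem twistedAction_lie (x y : M) :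
    twistedAction ρ f x ∘ₗ twistedAction ρ f y - twistedAction ρ f y ∘ₗ twistedAction ρ f x =
      -twistedAction ρ f ⁅x, y⁆ := by
  ext e
  simp only [twistedAction, LinearMap.sub_apply, LinearMap.comp_apply, LinearMap.mk₂_apply,
    LinearMap.neg_apply, ρ.op_lie, hf, map_sub, map_smul, smul_sub, zero_smul,
    _root_.sub_apply, mul_apply_eq_comp]
  rw [smul_comm (f y) (f x)]
  abel

theorem lieDerivative_lie (x y : M) (p : ℕ) :
    lieDerivative ρ f x p ∘ₗ lieDerivative ρ f y p =
      lieDerivative ρ f y p ∘ₗ lieDerivative ρ f x p - lieDerivative ρ f ⁅x, y⁆ p := by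
  have h1 := congrArg (LinearMap.rTensor (⋀[ℂ]^p M)) (twistedAction_lie ρ hf x y)
  have h2 := congrArg (LinearMap.lTensor E) (adDerivation_lie x y p)
  rw [LinearMap.rTensor_sub, LinearMap.rTensor_comp, LinearMap.rTensor_comp,
    LinearMap.rTensor_neg] at h1
  rw [LinearMap.lTensor_sub, LinearMap.lTensor_comp, LinearMap.lTensor_comp] at h2
  simp only [lieDerivative, LinearMap.comp_sub, LinearMap.sub_comp, ← h2,
    LinearMap.rTensor_comp_lTensor, LinearMap.lTensor_comp_rTensor]
  rw [← neg_eq_iff_eq_neg] at h1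
  rw [← h1]
  abel

/-- Induction on the degree through Cartan's formula and the commutation rules of Lie derivatives;
the identity `d ∘ d = 0` is not needed. -/
theorem boundary_comp_lieDerivative (x : M) (p : ℕ) :
    boundary ρ f p ∘ₗ lieDerivative ρ f x (p + 1) = lieDerivative ρ f x p ∘ₗ boundary ρ f p := by
  induction p with
  | zero =>
    refine tensor_exteriorPower_ext fun y => ?_
    rw [LinearMap.comp_assoc, lieDerivative_comp_tensorWedge, LinearMap.comp_sub,
      ← LinearMap.comp_assoc, boundary_zero_comp_tensorWedge, boundary_zero_comp_tensorWedge,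
      LinearMap.comp_assoc, boundary_zero_comp_tensorWedge, lieDerivative_lie ρ hf x y]
  | succ p ih =>
    refine tensor_exteriorPower_ext fun y => ?_
    rw [LinearMap.comp_assoc, lieDerivative_comp_tensorWedge, LinearMap.comp_sub,
      ← LinearMap.comp_assoc, boundary_succ_comp_tensorWedge, boundary_succ_comp_tensorWedge,
      LinearMap.comp_assoc, boundary_succ_comp_tensorWedge, LinearMap.comp_sub,
      lieDerivative_lie ρ hf x y, LinearMap.sub_comp, LinearMap.comp_assoc, ih, ← LinearMap.comp_assoc,
      ← LinearMap.comp_assoc, lieDerivative_comp_tensorWedge, LinearMap.sub_comp]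
    abel

/-- The Lie derivative is an invertible operator minus a commuting nilpotent one, hence bijective.
Since it commutes with the boundary, a cycle is the Lie derivative of a cycle, and Cartan's formula
exhibits it as a boundary. -/
theorem cycles_le_range_boundary {x : M} (hx : IsNilpotent (LieModule.toEnd ℂ M M x))
    (hu : IsUnit (ρ.op x - f x • (1 : E →L[ℂ] E))) (q : ℕ) :
    cycles ρ f q ≤ LinearMap.range (boundary ρ f q) := by
  have hunit : ∀ p, IsUnit (lieDerivative ρ f x p) := by
    intro p
    have hA : IsUnit (twistedAction ρ f x : Module.End ℂ E) := by
      convert hu.map (ContinuousLinearMap.toLinearMapRingHom (R₁ := ℂ) (M₁ := E)) using 1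
      ext e
      simp [twistedAction]
    rw [lieDerivative, sub_eq_add_neg]
    refine IsNilpotent.isUnit_add_left_of_commute ?_
      (hA.map (Module.End.rTensorAlgHom ℂ E (⋀[ℂ]^p M))) ?_
    · exact ((isNilpotent_adDerivation hx p).map (Module.End.lTensorAlgHom ℂ (⋀[ℂ]^p M) E)).neg
    · refine Commute.neg_left (?_ : Commute (((adDerivation x p).lTensor E :
        Module.End ℂ (E ⊗[ℂ] ⋀[ℂ]^p M))) ((twistedAction ρ f x).rTensor _))
      exact (LinearMap.lTensor_comp_rTensor _ _ _).trans
        (LinearMap.rTensor_comp_lTensor _ _ _).symm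
  have hbij : ∀ p, Function.Bijective (lieDerivative ρ f x p) := fun p =>
    (Module.End.isUnit_iff _).mp (hunit p)
  intro c hc
  obtain ⟨c, rfl⟩ := (hbij q).2 c
  refine ⟨tensorWedge E q x c, ?_⟩
  cases q with
  | zero => exact LinearMap.congr_fun (boundary_zero_comp_tensorWedge ρ f x) c
  | succ q =>
    have h1 := LinearMap.congr_fun (boundary_succ_comp_tensorWedge ρ f x q) c
    have h2 := LinearMap.congr_fun (boundary_comp_lieDerivative ρ hf x q) c
    have h3 : boundary ρ f q (lieDerivative ρ f x (q + 1) c) = 0 := hc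
    have h4 : boundary ρ f q c = 0 := (hbij q).1 (by
      rw [map_zero, ← h3]; exact h2.symm)
    rw [LinearMap.comp_apply, LinearMap.sub_apply, LinearMap.comp_apply, h4, map_zero, sub_zero] at h1
    exact h1

end Homotopy

/-- The joint spectrum of an ideal contained in the derived ideal is `{0}`. -/
theorem Sp_restrict_eq_zero {L : Type*} [LieRing L] [LieAlgebra ℂ L] [FiniteDimensional ℂ L]
    [LieAlgebra.IsSolvable L]
    {E : Type*} [NormedAddCommGroup E] [NormedSpace ℂ E] [CompleteSpace E] [Nontrivial E]
    (ρ : RightAction L E) {I : LieIdeal ℂ L}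
    (hI : I ≤ ⁅(⊤ : LieIdeal ℂ L), (⊤ : LieIdeal ℂ L)⁆) : Sp (ρ.restrict I) = {0} := by
  refine Set.Subset.antisymm ?_ (Set.singleton_subset_iff.mpr (zero_mem_Sp_restrict ρ I hI))
  rintro f ⟨hf, q, hq⟩
  by_contra hf0
  obtain ⟨x, hx⟩ : ∃ x, f x ≠ 0 := by
    by_contra! h
    exact hf0 (LinearMap.ext h)
  have hnil : IsNilpotent (LieModule.toEnd ℂ I I x) :=
    isNilpotent_toEnd_of_mem_derived (L := L) (V := I) (hI x.2)
  -- The negative of a right action is a left representation; hence the scalar `-f x` below.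
  have hneg : ∀ a b : L, (-ρ.op) ⁅a, b⁆ = (-ρ.op) a * (-ρ.op) b - (-ρ.op) b * (-ρ.op) a := by
    intro a b
    simp [ρ.op_lie]
  have hunit := isUnit_sub_smul_of_mem_derived hneg (hI x.2) (neg_ne_zero.mpr hx)
  have hunit' : IsUnit ((ρ.restrict I).op x - f x • (1 : E →L[ℂ] E)) := by
    rw [← IsUnit.neg_iff]
    convert hunit using 1
    change -(ρ.op (x : L) - f x • (1 : E →L[ℂ] E)) = -ρ.op (x : L) - (-f x) • 1
    module
  have hle := cycles_le_range_boundary (ρ.restrict I) hf hnil hunit' q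
  rw [Homology, Submodule.Quotient.nontrivial_iff] at hq
  exact hq (Submodule.submoduleOf_eq_top.mpr hle)

end LieSpectrum

theorem proposition7 {L : Type*} [LieRing L] [LieAlgebra ℂ L] [FiniteDimensional ℂ L]
    [LieAlgebra.IsSolvable L]
    {E : Type*} [NormedAddCommGroup E] [NormedSpace ℂ E] [CompleteSpace E] [Nontrivial E]
    (ρ : LieSpectrum.RightAction L E) :
    (∀ I : LieIdeal ℂ L, I ≤ ⁅(⊤ : LieIdeal ℂ L), (⊤ : LieIdeal ℂ L)⁆ →
      LieSpectrum.Sp (ρ.restrict I) = {0}) ∧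
    LieSpectrum.Sp (ρ.restrict ⁅(⊤ : LieIdeal ℂ L), (⊤ : LieIdeal ℂ L)⁆) =
      {0} :=
  ⟨fun _ hI => LieSpectrum.Sp_restrict_eq_zero ρ hI, LieSpectrum.Sp_restrict_eq_zero ρ le_rfl⟩
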